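/- Let $R$ be a commutative ring with unity; all algebras are associative and unital, and all maps are $R$-linear. A *hom-Lie-Rinehart algebra* $(A,L,[\,,],\varphi,\alpha,\rho)$ consists of a commutative $R$-algebra $A$, an $A$-module $L$, an $R$-algebra endomorphism $\varphi$ of $A$, an $R$-bilinear bracket on $L$ and a linear map $\alpha:L\to L$ with $[x,y]=-[y,x]$, $\alpha[x,y]=[\alpha x,\alpha y]$ and $[\alpha x,[y,z]]+[\alpha y,[z,x]]+[\alpha z,[x,y]]=0$, and a linear map $\rho$ from $L$ to the $\varphi$-derivations of $A$ (linear $\delta:A\to A$ with $\delta(ab)=\varphi(a)\delta(b)+\varphi(b)\delta(a)$), such that $\alpha(ax)=\varphi(a)\alpha(x)$, $\rho(\alpha x)\varphi=\varphi\rho(x)$, $\rho([x,y])\varphi=\rho(\alpha x)\rho(y)-\rho(\alpha y)\rho(x)$, $\rho(ax)=\varphi(a)\rho(x)$ and $[x,ay]=\varphi(a)[x,y]+\rho(x)(a)\alpha(y)$. A homomorphism is a pair $(g,f)$ of an $R$-algebra homomorphism $g:A\to A'$ and an $R$-linear map $f:L\to L'$ with $f(ax)=g(a)f(x)$ that commute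 with the brackets, with $\alpha,\varphi$ and with $\rho$ (that is, $g(\rho(x)(a))=\rho'(f(x))(g(a))$). A *hom-Gerstenhaber algebra* is a graded $R$-algebra $\mathcal A=\bigoplus_{i\ge 0}\mathcal A_i$ that is graded commutative in the strict sense ($XY=(-1)^{ij}YX$ for $X\in\mathcal A_i$, $Y\in\mathcal A_j$, and $X^2=0$ for $X$ homogeneous of odd degree), with an algebra endomorphism $\alpha$ of degree $0$ and a bilinear bracket of degree $-1$ satisfying, for $X,Y,Z$ of degrees $i,j,k$: $[X,Y]=-(-1)^{(i-1)(j-1)}[Y,X]$; $\alpha[X,Y]=[\alpha X,\alpha Y]$; $(-1)^{(i-1)(k-1)}[\alpha X,[Y,Z]]+(-1)^{(j-1)(i-1)}[\alpha Y,[Z,X]]+(-1)^{(k-1)(j-1)}[\alpha Z,[X,Y]]=0$; and $[X,Y\wedge Z]=[X,Y]\wedge\alpha(Z)+(-1)^{(i-1)j}\alpha(Y)\wedge[X,Z]$. Homomorphisms are the algebra homomorphisms of degree $0$ that commute with the brackets and with the endomorphisms $\alpha$. Let $\mathcal F$ be the functor sending a hom-Gerstenhaber algebra $\mathcal A$ to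 the hom-Lie-Rinehart algebra $(\mathcal A_0,\mathcal A_1)$ with the restricted operations, $\varphi=\alpha|_{\mathcal A_0}$ and $\rho(x)(a)=[x,a]$, and a homomorphism to its restriction. **Theorem.** For every hom-Lie-Rinehart algebra $(A,L,[\,,],\varphi,\alpha,\rho)$ the exterior algebra $\wedge_A^*L$ carries a hom-Gerstenhaber structure $([\,,]_G,\alpha_G)$ with $$\alpha_G(aX_1\wedge\cdots\wedge X_n)=\varphi(a)\,\alpha(X_1)\wedge\cdots\wedge\alpha(X_n)\quad(n\ge 0),$$ $$[X_1\wedge\cdots\wedge X_n,a]_G=\sum_{i=1}^n(-1)^{n-i}\rho(X_i)(a)\,\alpha_G(X_1\wedge\cdots\widehat{X_i}\cdots\wedge X_n)\quad(n\ge 1),$$ $$[X_1\wedge\cdots\wedge X_n,Y_1\wedge\cdots\wedge Y_m]_G=\sum_{i=1}^n\sum_{j=1}^m(-1)^{i+j}[X_i,Y_j]\wedge\alpha_G(X_1\wedge\cdots\widehat{X_i}\cdots\wedge X_n\wedge Y_1\wedge\cdots\widehat{Y_j}\cdots\wedge Y_m)\quad(n,m\ge 1)$$ for $X_i,Y_j\in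 L$, $a\in A$. The assignment $(A,L,[\,,],\varphi,\alpha,\rho)\mapsto(\wedge_A^*L,\wedge,[\,,]_G,\alpha_G)$, with $(g,f)\mapsto\bigl(aX_1\wedge\cdots\wedge X_n\mapsto g(a)f(X_1)\wedge\cdots\wedge f(X_n)\bigr)$ on homomorphisms, is a functor $\mathcal G$ from hom-Lie-Rinehart algebras to hom-Gerstenhaber algebras, and $\mathcal G$ is left adjoint to $\mathcal F$. -/

import Mathlib

open CategoryTheory
open scoped DirectSum

universe u v

/-! ## Hom-Lie algebras, representations, twisted derivations -/

section Basic

variable {R : Type u} [CommRing R]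

/-- `(𝔤, [-,-], α)` is a (multiplicative) hom-Lie algebra over `R`. -/
structure IsHomLie {𝔤 : Type v} [AddCommGroup 𝔤] [Module R 𝔤]
    (bracket : 𝔤 →ₗ[R] 𝔤 →ₗ[R] 𝔤) (α : 𝔤 →ₗ[R] 𝔤) : Prop where
  skew : ∀ x y, bracket x y = -bracket y x
  map_bracket : ∀ x y, α (bracket x y) = bracket (α x) (α y)
  jacobi : ∀ x y z,
    bracket (α x) (bracket y z) + bracket (α y) (bracket z x) + bracket (α z) (bracket x y) = 0

/-- `(θ, β)` is a representation of the hom-Lie algebra `(𝔤, [-,-], α)` on `V`. -/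
structure IsHomLieRep {𝔤 V : Type v} [AddCommGroup 𝔤] [Module R 𝔤] [AddCommGroup V] [Module R V]
    (bracket : 𝔤 →ₗ[R] 𝔤 →ₗ[R] 𝔤) (α : 𝔤 →ₗ[R] 𝔤)
    (θ : 𝔤 →ₗ[R] Module.End R V) (β : Module.End R V) : Prop where
  comm : ∀ x, θ (α x) ∘ₗ β = β ∘ₗ θ x
  bracket : ∀ x y, θ (bracket x y) ∘ₗ β = θ (α x) ∘ₗ θ y - θ (α y) ∘ₗ θ x

/-- `δ` is a `φ`-derivation of `A` into itself. -/
def IsTwistedDerivation {A : Type v} [CommRing A] [Algebra R A]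
    (φ : A →ₐ[R] A) (δ : A →ₗ[R] A) : Prop :=
  ∀ a b, δ (a * b) = φ a * δ b + φ b * δ a

end Basic

/-! ## The category of hom-Lie-Rinehart algebras -/

/-- A hom-Lie-Rinehart algebra `(A, L, [-,-], φ, α, ρ)` over `R`. -/
structure HomLieRinehart (R : Type u) [CommRing R] where
  A : Type v
  L : Type v
  [commRing : CommRing A]
  [algebra : Algebra R A]
  [addCommGroup : AddCommGroup L]
  [moduleR : Module R L]
  [moduleA : Module A L]
  [isScalarTower : IsScalarTower R A L]
  bracket : L →ₗ[R] L →ₗ[R] L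
  φ : A →ₐ[R] A
  α : L →ₗ[R] L
  ρ : L →ₗ[R] Module.End R A
  ρ_derivation : ∀ x, IsTwistedDerivation φ (ρ x)
  isHomLie : IsHomLie bracket α
  α_smul : ∀ (a : A) (x : L), α (a • x) = φ a • α x
  isRep : IsHomLieRep bracket α ρ φ.toLinearMap
  ρ_smul : ∀ (a : A) (x : L) (b : A), ρ (a • x) b = φ a * ρ x b
  leibniz : ∀ (x : L) (a : A) (y : L),
    bracket x (a • y) = φ a • bracket x y + ρ x a • α y

namespace HomLieRinehart

variable {R : Type u} [CommRing R]

attribute [instance] commRing algebra addCommGroup moduleR moduleA isScalarTower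

/-- A homomorphism `(g, f)` of hom-Lie-Rinehart algebras. -/
@[ext]
structure Hom (X Y : HomLieRinehart.{u, v} R) where
  g : X.A →ₐ[R] Y.A
  f : X.L →ₗ[R] Y.L
  map_smul : ∀ a x, f (a • x) = g a • f x
  map_bracket : ∀ x y, f (X.bracket x y) = Y.bracket (f x) (f y)
  map_α : ∀ x, f (X.α x) = Y.α (f x)
  map_φ : ∀ a, g (X.φ a) = Y.φ (g a)
  map_ρ : ∀ x a, g (X.ρ x a) = Y.ρ (f x) (g a)

instance : Category (HomLieRinehart.{u, v} R) where
  Hom := Hom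
  id X :=
    { g := AlgHom.id R X.A
      f := LinearMap.id
      map_smul := fun _ _ => rfl
      map_bracket := fun _ _ => rfl
      map_α := fun _ => rfl
      map_φ := fun _ => rfl
      map_ρ := fun _ _ => rfl }
  comp p q :=
    { g := q.g.comp p.g
      f := q.f ∘ₗ p.f
      map_smul := fun a x => by simp [p.map_smul, q.map_smul]
      map_bracket := fun x y => by simp [p.map_bracket, q.map_bracket]
      map_α := fun x => by simp [p.map_α, q.map_α]
      map_φ := fun a => by simp [p.map_φ, q.map_φ]
      map_ρ := fun x a => by simp [p.map_ρ, q.map_ρ] }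

end HomLieRinehart

/-! ## The category of hom-Gerstenhaber algebras -/

/-- A hom-Gerstenhaber structure on an `ℕ`-graded associative unital `R`-algebra `E = ⨁ᵢ 𝒜 i`.
Graded commutativity is meant in the strict sense (odd elements square to zero, which is
automatic when `2` is invertible). The signs `(-1) ^ ((i-1)(j-1))` are written
`(-1) ^ ((i+1)(j+1))`, which has the same parity and avoids subtraction in `ℕ`. -/
structure HomGerstenhaberStructure (R : Type u) [CommRing R] {E : Type v} [Ring E] [Algebra R E]
    (𝒜 : ℕ → Submodule R E) [GradedAlgebra 𝒜] where
  bracket : E →ₗ[R] E →ₗ[R] E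
  α : E →ₐ[R] E
  mul_comm : ∀ ⦃i j : ℕ⦄ ⦃x y : E⦄, x ∈ 𝒜 i → y ∈ 𝒜 j →
    x * y = (-1 : R) ^ (i * j) • (y * x)
  mul_self : ∀ ⦃i : ℕ⦄ ⦃x : E⦄, Odd i → x ∈ 𝒜 i → x * x = 0
  α_mem : ∀ ⦃i : ℕ⦄ ⦃x : E⦄, x ∈ 𝒜 i → α x ∈ 𝒜 i
  -- the bracket has degree `-1`, where the component of degree `-1` is zero
  bracket_mem : ∀ ⦃i j k : ℕ⦄ ⦃x y : E⦄, i + j = k + 1 → x ∈ 𝒜 i → y ∈ 𝒜 j →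
    bracket x y ∈ 𝒜 k
  bracket_zero_zero : ∀ ⦃x y : E⦄, x ∈ 𝒜 0 → y ∈ 𝒜 0 → bracket x y = 0
  skew : ∀ ⦃i j : ℕ⦄ ⦃x y : E⦄, x ∈ 𝒜 i → y ∈ 𝒜 j →
    bracket x y = -((-1 : R) ^ ((i + 1) * (j + 1)) • bracket y x)
  map_bracket : ∀ x y, α (bracket x y) = bracket (α x) (α y)
  jacobi : ∀ ⦃i j k : ℕ⦄ ⦃x y z : E⦄, x ∈ 𝒜 i → y ∈ 𝒜 j → z ∈ 𝒜 k →
    (-1 : R) ^ ((i + 1) * (k + 1)) • bracket (α x) (bracket y z)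
      + (-1 : R) ^ ((j + 1) * (i + 1)) • bracket (α y) (bracket z x)
      + (-1 : R) ^ ((k + 1) * (j + 1)) • bracket (α z) (bracket x y) = 0
  leibniz : ∀ ⦃i j k : ℕ⦄ ⦃x y z : E⦄, x ∈ 𝒜 i → y ∈ 𝒜 j → z ∈ 𝒜 k →
    bracket x (y * z) = bracket x y * α z + (-1 : R) ^ ((i + 1) * j) • (α y * bracket x z)

/-- `Θ` is a homomorphism of hom-Gerstenhaber algebras. -/
structure IsHomGerstenhaberHom {R : Type u} [CommRing R]
    {E F : Type v} [Ring E] [Algebra R E] [Ring F] [Algebra R F]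
    {𝒜 : ℕ → Submodule R E} [GradedAlgebra 𝒜] {ℬ : ℕ → Submodule R F} [GradedAlgebra ℬ]
    (S : HomGerstenhaberStructure R 𝒜) (T : HomGerstenhaberStructure R ℬ)
    (Θ : E →ₐ[R] F) : Prop where
  map_mem : ∀ ⦃i : ℕ⦄ ⦃x : E⦄, x ∈ 𝒜 i → Θ x ∈ ℬ i
  map_bracket : ∀ x y, Θ (S.bracket x y) = T.bracket (Θ x) (Θ y)
  map_α : ∀ x, Θ (S.α x) = T.α (Θ x)

/-- A hom-Gerstenhaber algebra over `R`. -/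
structure HomGerstenhaber (R : Type u) [CommRing R] where
  E : Type v
  [ring : Ring E]
  [algebra : Algebra R E]
  grading : ℕ → Submodule R E
  [gradedAlgebra : GradedAlgebra grading]
  str : HomGerstenhaberStructure R grading

namespace HomGerstenhaber

variable {R : Type u} [CommRing R]

attribute [instance] ring algebra gradedAlgebra

/-- A homomorphism of hom-Gerstenhaber algebras. -/
@[ext]
structure Hom (X Y : HomGerstenhaber.{u, v} R) where
  toAlgHom : X.E →ₐ[R] Y.E
  isHom : IsHomGerstenhaberHom X.str Y.str toAlgHom

instance : Category (HomGerstenhaber.{u, v} R) where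
  Hom := Hom
  id X := ⟨AlgHom.id R X.E, ⟨fun _ _ h => h, fun _ _ => rfl, fun _ => rfl⟩⟩
  comp p q := ⟨q.toAlgHom.comp p.toAlgHom,
    ⟨fun _ _ h => q.isHom.map_mem (p.isHom.map_mem h),
     fun x y => by simp [p.isHom.map_bracket, q.isHom.map_bracket],
     fun x => by simp [p.isHom.map_α, q.isHom.map_α]⟩⟩

/-! ### The degree zero and degree one parts -/

variable (X : HomGerstenhaber.{u, v} R)

/-- The component of degree zero. -/
abbrev deg0 : Type v := X.grading 0

/-- The component of degree one. -/
abbrev deg1 : Type v := X.grading 1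

/-- `𝒜₀` is a commutative ring under `∧`. -/
instance : CommRing X.deg0 :=
  { (inferInstance : Ring X.deg0) with
    mul_comm := fun a b => Subtype.ext (by
      have := X.str.mul_comm a.2 b.2
      simpa using this) }

theorem coe_mul0 (a b : X.deg0) : ((a * b : X.deg0) : X.E) = a * b := rfl

/-- `𝒜₁` is a module over `𝒜₀` under `∧`. -/
instance : Module X.deg0 X.deg1 where
  smul a x := ⟨(a : X.E) * x, by
    simpa using SetLike.GradedMul.mul_mem (A := X.grading) a.2 x.2⟩
  one_smul x := Subtype.ext (one_mul (x : X.E))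
  mul_smul a b x := Subtype.ext (mul_assoc (a : X.E) b x)
  smul_zero a := Subtype.ext (mul_zero (a : X.E))
  smul_add a x y := Subtype.ext (mul_add (a : X.E) x y)
  add_smul a b x := Subtype.ext (add_mul (a : X.E) b x)
  zero_smul x := Subtype.ext (zero_mul (x : X.E))

theorem coe_smul01 (a : X.deg0) (x : X.deg1) : ((a • x : X.deg1) : X.E) = a * x := rfl

instance : IsScalarTower R X.deg0 X.deg1 where
  smul_assoc r a x := Subtype.ext (smul_mul_assoc r (a : X.E) (x : X.E))

/-- The restriction of the bracket to `𝒜₁ ⊗ 𝒜₁ → 𝒜₁`. -/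
def bracket11 : X.deg1 →ₗ[R] X.deg1 →ₗ[R] X.deg1 :=
  LinearMap.mk₂ R (fun x y => ⟨X.str.bracket x y, X.str.bracket_mem (i := 1) (j := 1) (k := 1) rfl x.2 y.2⟩)
    (fun _ _ _ => Subtype.ext (by simp)) (fun _ _ _ => Subtype.ext (by simp))
    (fun _ _ _ => Subtype.ext (by simp)) (fun _ _ _ => Subtype.ext (by simp))

/-- The restriction of the bracket to `𝒜₁ ⊗ 𝒜₀ → 𝒜₀`. -/
def bracket10 : X.deg1 →ₗ[R] Module.End R X.deg0 :=
  LinearMap.mk₂ R (fun x a => ⟨X.str.bracket x a, X.str.bracket_mem (i := 1) (j := 0) (k := 0) rfl x.2 a.2⟩)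
    (fun _ _ _ => Subtype.ext (by simp)) (fun _ _ _ => Subtype.ext (by simp))
    (fun _ _ _ => Subtype.ext (by simp)) (fun _ _ _ => Subtype.ext (by simp))

/-- The restriction of a homomorphism to the components of degree zero. -/
def Hom.map0 {X Y : HomGerstenhaber.{u, v} R} (p : Hom X Y) : X.deg0 →ₐ[R] Y.deg0 where
  toFun a := ⟨p.toAlgHom a, p.isHom.map_mem a.2⟩
  map_one' := Subtype.ext (map_one p.toAlgHom)
  map_mul' a b := Subtype.ext (map_mul p.toAlgHom (a : X.E) b)
  map_zero' := Subtype.ext (map_zero p.toAlgHom)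
  map_add' a b := Subtype.ext (map_add p.toAlgHom (a : X.E) b)
  commutes' r := Subtype.ext (p.toAlgHom.commutes r)

/-- The restriction of a homomorphism to the components of degree one. -/
def Hom.map1 {X Y : HomGerstenhaber.{u, v} R} (p : Hom X Y) : X.deg1 →ₗ[R] Y.deg1 :=
  p.toAlgHom.toLinearMap.restrict (p := X.grading 1) (q := Y.grading 1)
    fun _ h => p.isHom.map_mem h

/-- The restriction of `α` to `𝒜₀`. -/
def α0 : X.deg0 →ₐ[R] X.deg0 where
  toFun a := ⟨X.str.α a, X.str.α_mem a.2⟩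
  map_one' := Subtype.ext (map_one X.str.α)
  map_mul' a b := Subtype.ext (map_mul X.str.α (a : X.E) b)
  map_zero' := Subtype.ext (map_zero X.str.α)
  map_add' a b := Subtype.ext (map_add X.str.α (a : X.E) b)
  commutes' r := Subtype.ext (X.str.α.commutes r)

/-- The restriction of `α` to `𝒜₁`. -/
def α1 : X.deg1 →ₗ[R] X.deg1 :=
  X.str.α.toLinearMap.restrict (p := X.grading 1) (q := X.grading 1) fun _ h => X.str.α_mem h

theorem mul_comm0 {i : ℕ} {a x : X.E} (ha : a ∈ X.grading 0) (hx : x ∈ X.grading i) :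
    a * x = x * a := by
  simpa using X.str.mul_comm ha hx

/-- The hom-Lie-Rinehart algebra `(𝒜₀, 𝒜₁)` of a hom-Gerstenhaber algebra `𝒜`, with anchor
`ρ(x)(a) = [x, a]`. -/
def toHomLieRinehart : HomLieRinehart.{u, v} R where
  A := X.deg0
  L := X.deg1
  bracket := X.bracket11
  φ := X.α0
  α := X.α1
  ρ := X.bracket10
  ρ_derivation x a b := Subtype.ext (by
    have h := X.str.leibniz x.2 a.2 b.2
    have h1 := X.mul_comm0 (X.α0 b).2 (X.bracket10 x a).2
    have h2 : X.str.bracket x ((a : X.E) * b)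
        = (X.α0 a : X.E) * X.bracket10 x b + (X.α0 b : X.E) * X.bracket10 x a := by
      rw [h1, h, add_comm]
      simp [α0, bracket10]
    exact h2)
  isHomLie :=
    { skew := fun x y => Subtype.ext (by
        have h := X.str.skew x.2 y.2
        norm_num at h
        exact h)
      map_bracket := fun x y => Subtype.ext (X.str.map_bracket x y)
      jacobi := fun x y z => Subtype.ext (by
        have h := X.str.jacobi x.2 y.2 z.2
        norm_num at h
        exact h) }
  α_smul a x := Subtype.ext (map_mul X.str.α (a : X.E) x)
  isRep :=
    { comm := fun x => LinearMap.ext fun a => Subtype.ext (X.str.map_bracket x a).symm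
      bracket := fun x y => LinearMap.ext fun a => Subtype.ext (by
        have h := X.str.jacobi x.2 y.2 a.2
        have h1 := X.str.skew a.2 x.2
        have h2 := X.str.skew (X.str.α_mem a.2) (X.str.bracket_mem (k := 1) rfl x.2 y.2)
        norm_num at h h1 h2
        rw [h1, h2, map_neg] at h
        have h3 : X.str.bracket (X.str.bracket x y) (X.str.α a)
            = X.str.bracket (X.str.α x) (X.str.bracket y a)
              - X.str.bracket (X.str.α y) (X.str.bracket x a) := by
          rw [← sub_eq_zero, ← neg_eq_zero, ← h]
          abel
        exact h3) }
  ρ_smul a x b := Subtype.ext (by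
    have h := X.str.leibniz b.2 a.2 x.2
    have h1 := X.str.skew (a • x).2 b.2
    have h2 := X.str.skew b.2 x.2
    have h3 := X.str.bracket_zero_zero b.2 a.2
    rw [coe_smul01] at h1
    norm_num at h h1 h2
    have h4 : X.str.bracket ((a : X.E) * x) b = X.str.α a * X.str.bracket x b := by
      rw [h1, h, h3, h2]
      simp
    exact h4)
  leibniz x a y := Subtype.ext (by
    have h := X.str.leibniz x.2 a.2 y.2
    norm_num at h
    rw [add_comm] at h
    exact h)

end HomGerstenhaber

/-- The functor `ℱ` sending a hom-Gerstenhaber algebra `𝒜` to `(𝒜₀, 𝒜₁)` and a homomorphism to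
its restriction. -/
def functorF (R : Type u) [CommRing R] :
    HomGerstenhaber.{u, v} R ⥤ HomLieRinehart.{u, v} R where
  obj X := X.toHomLieRinehart
  map {X Y} p :=
    { g := HomGerstenhaber.Hom.map0 p
      f := HomGerstenhaber.Hom.map1 p
      map_smul := fun a x => Subtype.ext (map_mul p.toAlgHom (a : X.deg0).1 (x : X.deg1).1)
      map_bracket := fun x y => Subtype.ext (p.isHom.map_bracket _ _)
      map_α := fun x => Subtype.ext (p.isHom.map_α _)
      map_φ := fun a => Subtype.ext (p.isHom.map_α _)
      map_ρ := fun x a => Subtype.ext (p.isHom.map_bracket _ _) }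

/-! ## The exterior algebra of a hom-Lie-Rinehart algebra -/

namespace HomLieRinehart

variable {R : Type u} [CommRing R]

/-- The underlying algebra `∧*_A L` of `𝒢(A, L)`. -/
abbrev Ext (X : HomLieRinehart.{u, v} R) : Type v := ExteriorAlgebra X.A X.L

/-- The grading of `∧*_A L` by the exterior powers, regarded as `R`-submodules. -/
def extGrading (X : HomLieRinehart.{u, v} R) (i : ℕ) : Submodule R X.Ext :=
  (⋀[X.A]^i X.L).restrictScalars R

instance (X : HomLieRinehart.{u, v} R) : GradedAlgebra X.extGrading :=
  let D : GradedAlgebra (fun i : ℕ => ⋀[X.A]^i X.L) := inferInstance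
  { one_mem := D.one_mem
    mul_mem := fun _ _ _ _ ha hb => D.mul_mem ha hb
    decompose' := D.decompose'
    left_inv := D.left_inv
    right_inv := D.right_inv }

/-- The ring homomorphism `∧*_A L → ∧*_B M` extending `(g, f)`. -/
noncomputable def extRingHom {X Y : HomLieRinehart.{u, v} R} (p : X ⟶ Y) : X.Ext →+* Y.Ext :=
  letI : Algebra X.A Y.Ext := ((algebraMap Y.A Y.Ext).comp p.g.toRingHom).toAlgebra'
    (fun a x => Algebra.commutes (p.g a) x)
  (ExteriorAlgebra.lift X.A (M := X.L) (A := Y.Ext)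
    ⟨{ toFun := fun x => ExteriorAlgebra.ι Y.A (p.f x)
       map_add' := fun x y => by simp
       map_smul' := fun a x => by
        rw [p.map_smul, _root_.map_smul, Algebra.smul_def]; rfl },
     fun x => ExteriorAlgebra.ι_sq_zero (p.f x)⟩).toRingHom

theorem extRingHom_algebraMap {X Y : HomLieRinehart.{u, v} R} (p : X ⟶ Y) (a : X.A) :
    extRingHom p (algebraMap X.A X.Ext a) = algebraMap Y.A Y.Ext (p.g a) :=
  letI : Algebra X.A Y.Ext := ((algebraMap Y.A Y.Ext).comp p.g.toRingHom).toAlgebra'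
    (fun a x => Algebra.commutes (p.g a) x)
  AlgHom.commutes (ExteriorAlgebra.lift X.A (M := X.L) (A := Y.Ext) _) a

theorem extRingHom_ι {X Y : HomLieRinehart.{u, v} R} (p : X ⟶ Y) (x : X.L) :
    extRingHom p (ExteriorAlgebra.ι X.A x) = ExteriorAlgebra.ι Y.A (p.f x) :=
  letI : Algebra X.A Y.Ext := ((algebraMap Y.A Y.Ext).comp p.g.toRingHom).toAlgebra'
    (fun a x => Algebra.commutes (p.g a) x)
  ExteriorAlgebra.lift_ι_apply X.A (A := Y.Ext) _ _ x

/-- The homomorphism `∧*_A L → ∧*_B M` of graded `R`-algebras extending `(g, f)`: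
`a X₁ ∧ ⋯ ∧ Xₙ ↦ g(a) f(X₁) ∧ ⋯ ∧ f(Xₙ)`. -/
noncomputable def extMap {X Y : HomLieRinehart.{u, v} R} (p : X ⟶ Y) : X.Ext →ₐ[R] Y.Ext :=
  { extRingHom p with
    commutes' := fun r => by
      change extRingHom p (algebraMap R X.Ext r) = algebraMap R Y.Ext r
      rw [IsScalarTower.algebraMap_apply R X.A X.Ext, IsScalarTower.algebraMap_apply R Y.A Y.Ext,
        extRingHom_algebraMap, p.g.commutes] }

theorem extMap_algebraMap {X Y : HomLieRinehart.{u, v} R} (p : X ⟶ Y) (a : X.A) :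
    extMap p (algebraMap X.A X.Ext a) = algebraMap Y.A Y.Ext (p.g a) :=
  extRingHom_algebraMap p a

theorem extMap_ι {X Y : HomLieRinehart.{u, v} R} (p : X ⟶ Y) (x : X.L) :
    extMap p (ExteriorAlgebra.ι X.A x) = ExteriorAlgebra.ι Y.A (p.f x) :=
  extRingHom_ι p x

theorem extMap_id (X : HomLieRinehart.{u, v} R) : extMap (𝟙 X) = AlgHom.id R X.Ext := by
  ext z
  induction z using ExteriorAlgebra.induction with
  | algebraMap a => exact extMap_algebraMap (𝟙 X) a
  | ι x => exact extMap_ι (𝟙 X) x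
  | mul a b ha hb => rw [map_mul, ha, hb]; rfl
  | add a b ha hb => rw [map_add, ha, hb]; rfl

theorem extMap_comp {X Y Z : HomLieRinehart.{u, v} R} (p : X ⟶ Y) (q : Y ⟶ Z) :
    extMap (p ≫ q) = (extMap q).comp (extMap p) := by
  ext z
  induction z using ExteriorAlgebra.induction with
  | algebraMap a =>
    rw [AlgHom.comp_apply, extMap_algebraMap, extMap_algebraMap, extMap_algebraMap]; rfl
  | ι x => rw [AlgHom.comp_apply, extMap_ι, extMap_ι, extMap_ι]; rfl
  | mul a b ha hb => rw [map_mul, ha, hb, map_mul]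
  | add a b ha hb => rw [map_add, ha, hb, map_add]

/-- The hom-Gerstenhaber structure `S` on `∧*_A L` is given by the twisted Schouten formulas.
The indices of `X₁, …, Xₙ₊₁` are counted from `0`, and `i.removeNth x` omits the `i`-th entry.
Together with `R`-bilinearity, degree `-1` and graded skew-symmetry these formulas
determine `S`. -/
structure IsSchouten (X : HomLieRinehart.{u, v} R)
    (S : HomGerstenhaberStructure R X.extGrading) : Prop where
  α_apply : ∀ (a : X.A) (n : ℕ) (x : Fin n → X.L),
    S.α (algebraMap X.A X.Ext a * ExteriorAlgebra.ιMulti X.A n x)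
      = algebraMap X.A X.Ext (X.φ a) * ExteriorAlgebra.ιMulti X.A n (fun i => X.α (x i))
  bracket_algebraMap : ∀ (n : ℕ) (x : Fin (n + 1) → X.L) (a : X.A),
    S.bracket (ExteriorAlgebra.ιMulti X.A (n + 1) x) (algebraMap X.A X.Ext a)
      = ∑ i : Fin (n + 1), (-1 : R) ^ (n + (i : ℕ)) •
          (algebraMap X.A X.Ext (X.ρ (x i) a)
            * S.α (ExteriorAlgebra.ιMulti X.A n (i.removeNth x)))
  bracket_ιMulti : ∀ (n m : ℕ) (x : Fin (n + 1) → X.L) (y : Fin (m + 1) → X.L),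
    S.bracket (ExteriorAlgebra.ιMulti X.A (n + 1) x) (ExteriorAlgebra.ιMulti X.A (m + 1) y)
      = ∑ i : Fin (n + 1), ∑ j : Fin (m + 1), (-1 : R) ^ ((i : ℕ) + (j : ℕ)) •
          (ExteriorAlgebra.ι X.A (X.bracket (x i) (y j))
            * S.α (ExteriorAlgebra.ιMulti X.A n (i.removeNth x)
                * ExteriorAlgebra.ιMulti X.A m (j.removeNth y)))

end HomLieRinehart

/-- The functor `(A, L) ↦ ∧*_A L`, `(g, f) ↦ ∧*(g, f)` determined by a hom-Gerstenhaber structure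
on each `∧*_A L` that is respected by all the maps `∧*(g, f)`. -/
noncomputable def functorG {R : Type u} [CommRing R]
    (S : ∀ X : HomLieRinehart.{u, v} R, HomGerstenhaberStructure R X.extGrading)
    (hS : ∀ (X Y : HomLieRinehart.{u, v} R) (p : X ⟶ Y),
      IsHomGerstenhaberHom (S X) (S Y) (HomLieRinehart.extMap p)) :
    HomLieRinehart.{u, v} R ⥤ HomGerstenhaber.{u, v} R where
  obj X := { E := X.Ext, grading := X.extGrading, str := S X }
  map {X Y} p := ⟨HomLieRinehart.extMap p, hS X Y p⟩
  map_id X := HomGerstenhaber.Hom.ext (HomLieRinehart.extMap_id X)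
  map_comp p q := HomGerstenhaber.Hom.ext (HomLieRinehart.extMap_comp p q)

/-! The Leibniz rule determines a bracket by its values on `A` and `L`, so everything is built from
these generators and checked on them. For `U` of degree `n`, the operator `[U,-]` must satisfy
`D(YZ) = D(Y)t(Z) + s(Y)D(Z)`, where `t` is the twist `α_G` and `s` is `α_G` times `(-1)^((n+1)j)`
in degree `j`, again an algebra endomorphism. Such a `D` amounts to an algebra homomorphism into
upper triangular 2×2 matrices with diagonal `(s, t)`, so the universal property of the exterior
algebra produces it from compatible values on generators (`exists_derivation`). Skew-symmetry
dictates these values in two rounds: `[a,-]` and `[y,-]` come from `ρ` and the bracket of `L`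
(`adScalar`, `adVector`); then `[U,a] = (-1)^n [a,U]` and `[U,x] = -[x,U]` define `[U,-]`
(`exists_adHomogeneous`).

Skew-symmetry in general follows from a Leibniz rule in the first slot (`extBracket_ι_mul_left`).
The Jacobi identity, read as a formula for the graded commutator of `[U,-]` and `[V,-]`, extends
from generators `Z` to all `Z` (`jacobiAt_of_generators`). It is also cyclically symmetric
(`JacobiAt.rotate`), so each slot in turn reduces to generators, where the hom-Lie-Rinehart axioms
apply.

For the adjunction, a homomorphism out of `∧_A L` is determined on `A` and `L`. Conversely a pair
`(g, f)` extends multiplicatively, since degree-one elements square to zero and commute with degree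
zero, and compatibility with the brackets again only needs generators
(`isHomGerstenhaberHom_of_generators`). -/

theorem neg_one_pow_eq_of_zmod_two {R : Type*} [CommRing R] {m n : ℕ} (h : (m : ZMod 2) = n) :
    (-1 : R) ^ m = (-1) ^ n := by
  rw [ZMod.natCast_eq_natCast_iff'] at h
  rw [neg_one_pow_eq_pow_mod_two, h, ← neg_one_pow_eq_pow_mod_two]

/-! ### Semilinear homomorphisms and twisted derivations out of an exterior algebra. -/

namespace ExteriorAlgebra

section SemiLift

variable {R : Type*} {A : Type*} {L : Type*} {T : Type*} [CommRing R] [CommRing A] [Algebra R A]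
  [AddCommGroup L] [Module R L] [Module A L] [IsScalarTower R A L] [Ring T] [Algebra R T]

/-- The `R`-algebra homomorphism out of `∧_A L` determined by an `R`-algebra homomorphism on `A`
and a compatible `R`-linear map on `L`. -/
theorem exists_semiLift (g : A →ₐ[R] T) (f : L →ₗ[R] T)
    (hsmul : ∀ a x, f (a • x) = g a * f x) (hcomm : ∀ a x, g a * f x = f x * g a)
    (hsq : ∀ x, f x * f x = 0) :
    ∃ F : ExteriorAlgebra A L →ₐ[R] T,
      (∀ a, F (algebraMap A _ a) = g a) ∧ ∀ x, F (ι A x) = f x := by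
  -- `T` need not be an `A`-algebra, because `g` may have non-central values. The centralizer of its
  -- image is one, and it contains the values of `g` and `f`.
  let C : Subalgebra R T := Subalgebra.centralizer R (Set.range g)
  have hg : ∀ a, g a ∈ C := by
    intro a
    rw [Subalgebra.mem_centralizer_iff]
    rintro _ ⟨b, rfl⟩
    rw [← map_mul, ← map_mul, mul_comm]
  have hf : ∀ x, f x ∈ C := by
    intro x
    rw [Subalgebra.mem_centralizer_iff]
    rintro _ ⟨b, rfl⟩
    exact hcomm b x
  let _ : Algebra A C := (g.codRestrict C hg).toRingHom.toAlgebra' (fun a x => Subtype.ext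
    ((Subalgebra.mem_centralizer_iff R).1 x.2 _ ⟨a, rfl⟩))
  let F : ExteriorAlgebra A L →ₐ[A] C := lift A (M := L) (A := C)
    ⟨{ toFun := fun x => ⟨f x, hf x⟩
       map_add' := fun x y => Subtype.ext (by simp)
       map_smul' := fun a x => by
        rw [Algebra.smul_def]
        exact Subtype.ext (hsmul a x) },
     fun x => Subtype.ext (hsq x)⟩
  have hF : ∀ a, (F (algebraMap A _ a) : T) = g a := fun a =>
    congrArg Subtype.val (F.commutes a)
  refine ⟨{ (C.val.toRingHom.comp F.toRingHom) with
    commutes' := fun r => ?_ }, hF, fun x => ?_⟩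
  · change (F (algebraMap R _ r) : T) = _
    rw [IsScalarTower.algebraMap_apply R A, hF, g.commutes]
  · exact congrArg Subtype.val (lift_ι_apply A (A := C) _ _ x)

theorem linearMap_ext_left {N : Type*} [AddCommGroup N] [Module R N]
    {D D' : ExteriorAlgebra A L →ₗ[R] N}
    (h0 : ∀ a, D (algebraMap A _ a) = D' (algebraMap A _ a))
    (h1 : ∀ x W, D W = D' W → D (ι A x * W) = D' (ι A x * W)) : D = D' := by
  ext z
  induction z using CliffordAlgebra.left_induction with
  | algebraMap a => exact h0 a
  | add x y hx hy => rw [map_add, map_add, hx, hy]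
  | ι_mul x m h => exact h1 m x h

theorem algHom_ext' {F G : ExteriorAlgebra A L →ₐ[R] T}
    (h0 : ∀ a, F (algebraMap A _ a) = G (algebraMap A _ a))
    (h1 : ∀ x, F (ι A x) = G (ι A x)) : F = G :=
  AlgHom.toLinearMap_injective (linearMap_ext_left h0 fun x W h => by
    rw [AlgHom.toLinearMap_apply, AlgHom.toLinearMap_apply] at *
    rw [map_mul, map_mul, h1, h])

/-- An `(s, t)`-derivation on `∧_A L` with prescribed restrictions to `A` and `L`. -/
theorem exists_derivation (s t : ExteriorAlgebra A L →ₐ[R] T)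
    (d₀ : A →ₗ[R] T) (d₁ : L →ₗ[R] T)
    (h00 : ∀ a b, d₀ (a * b) = d₀ a * t (algebraMap A _ b) + s (algebraMap A _ a) * d₀ b)
    (h01 : ∀ a x, d₁ (a • x) = d₀ a * t (ι A x) + s (algebraMap A _ a) * d₁ x)
    (h10 : ∀ a x, d₁ (a • x) = d₁ x * t (algebraMap A _ a) + s (ι A x) * d₀ a)
    (h11 : ∀ x, d₁ x * t (ι A x) + s (ι A x) * d₁ x = 0) :
    ∃ D : ExteriorAlgebra A L →ₗ[R] T,
      (∀ a, D (algebraMap A _ a) = d₀ a) ∧ (∀ x, D (ι A x) = d₁ x) ∧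
      ∀ Y Z, D (Y * Z) = D Y * t Z + s Y * D Z := by
  have hone : d₀ 1 = 0 := by simpa using h00 1 1
  -- The upper right entry of a product of two such matrices is `s Y * D Z + D Y * t Z`. Thus `h00`
  -- gives multiplicativity on `A`, `h01` semilinearity on `L`, the agreement of `h01` with `h10`
  -- commutation of the two, and `h11` squares equal to zero.
  obtain ⟨F, hF0, hF1⟩ := exists_semiLift (R := R) (A := A) (L := L)
    (T := Matrix (Fin 2) (Fin 2) T)
    { toFun := fun a => !![s (algebraMap A _ a), d₀ a; 0, t (algebraMap A _ a)]
      map_one' := by simp [hone, Matrix.one_fin_two]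
      map_mul' := fun a b => by simp [h00, add_comm]
      map_zero' := by ext i j; fin_cases i <;> fin_cases j <;> simp
      map_add' := fun a b => by simp
      commutes' := fun r => by
        have h : d₀ (algebraMap R A r) = 0 := by
          rw [Algebra.algebraMap_eq_smul_one, map_smul, hone, smul_zero]
        rw [h, ← IsScalarTower.algebraMap_apply, s.commutes, t.commutes]
        ext i j; fin_cases i <;> fin_cases j <;> simp [Matrix.algebraMap_matrix_apply] }
    { toFun := fun x => !![s (ι A x), d₁ x; 0, t (ι A x)]
      map_add' := fun a b => by simp
      map_smul' := fun r x => by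
        have h : ι A (r • x) = r • ι A x := ((ι A).restrictScalars R).map_smul r x
        ext i j; fin_cases i <;> fin_cases j <;> simp [h] }
    (fun a x => by
      have h : ι A (a • x) = algebraMap A _ a * ι A x := by rw [map_smul, Algebra.smul_def]
      simp [h01, h, add_comm])
    (fun a x => by
      have h2 := (h01 a x).symm.trans (h10 a x)
      have hc := Algebra.commutes a (ι A x)
      have hs := congrArg s hc
      have ht := congrArg t hc
      rw [map_mul, map_mul] at hs ht
      rw [add_comm, add_comm (d₁ x * _)] at h2
      simp [hs, ht, h2])
    (fun x => by
      have hs := congrArg s (ι_sq_zero (R := A) x)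
      have ht := congrArg t (ι_sq_zero (R := A) x)
      rw [map_mul, map_zero] at hs ht
      have h := h11 x
      rw [add_comm] at h
      ext i j; fin_cases i <;> fin_cases j <;> simp [h, hs, ht])
  have key : ∀ Y, F Y 0 0 = s Y ∧ F Y 1 0 = 0 ∧ F Y 1 1 = t Y := by
    intro Y
    induction Y using ExteriorAlgebra.induction with
    | algebraMap a => rw [hF0]; exact ⟨rfl, rfl, rfl⟩
    | ι x => rw [hF1]; exact ⟨rfl, rfl, rfl⟩
    | mul a b ha hb => simp [Matrix.mul_apply, Fin.sum_univ_two, ha, hb]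
    | add a b ha hb => simp [ha, hb]
  refine ⟨{ toFun := fun Y => F Y 0 1
            map_add' := fun x y => by simp
            map_smul' := fun r x => by simp }, fun a => ?_, fun x => ?_, fun Y Z => ?_⟩
  · change F _ 0 1 = _
    rw [hF0]; rfl
  · change F _ 0 1 = _
    rw [hF1]; rfl
  · change F (Y * Z) 0 1 = F Y 0 1 * _ + _ * F Z 0 1
    rw [map_mul, Matrix.mul_apply, Fin.sum_univ_two, (key Y).1, (key Z).2.2, add_comm]

/-- Linearity in the parameter is free: a twisted derivation is determined by its values on
generators, and these depend linearly on `n`. -/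
theorem exists_derivation_family {N : Type*} [AddCommGroup N] [Module R N]
    (s t : ExteriorAlgebra A L →ₐ[R] T)
    (d₀ : N →ₗ[R] A →ₗ[R] T) (d₁ : N →ₗ[R] L →ₗ[R] T)
    (h00 : ∀ n a b,
      d₀ n (a * b) = d₀ n a * t (algebraMap A _ b) + s (algebraMap A _ a) * d₀ n b)
    (h01 : ∀ n a x, d₁ n (a • x) = d₀ n a * t (ι A x) + s (algebraMap A _ a) * d₁ n x)
    (h10 : ∀ n a x, d₁ n (a • x) = d₁ n x * t (algebraMap A _ a) + s (ι A x) * d₀ n a)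
    (h11 : ∀ n x, d₁ n x * t (ι A x) + s (ι A x) * d₁ n x = 0) :
    ∃ D : N →ₗ[R] ExteriorAlgebra A L →ₗ[R] T,
      (∀ n a, D n (algebraMap A _ a) = d₀ n a) ∧ (∀ n x, D n (ι A x) = d₁ n x) ∧
      ∀ n Y Z, D n (Y * Z) = D n Y * t Z + s Y * D n Z := by
  choose D hD0 hD1 hD using fun n =>
    exists_derivation s t (d₀ n) (d₁ n) (h00 n) (h01 n) (h10 n) (h11 n)
  refine ⟨{ toFun := D
            map_add' := fun m n => linearMap_ext_left (fun a => ?_) (fun x W h => ?_)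
            map_smul' := fun r n => linearMap_ext_left (fun a => ?_) (fun x W h => ?_) },
    hD0, hD1, hD⟩
  · simp [hD0]
  · simp only [LinearMap.add_apply] at h ⊢
    simp only [hD, hD1, h, map_add, LinearMap.add_apply]
    noncomm_ring
  · simp [hD0]
  · simp only [LinearMap.smul_apply, RingHom.id_apply] at h ⊢
    simp only [hD, hD1, h, map_smul, LinearMap.smul_apply, smul_add, smul_mul_assoc,
      mul_smul_comm]

end SemiLift

/-! ### Graded commutativity of the exterior algebra. -/

section GradedCommutative

variable {A : Type*} {L : Type*} [CommRing A] [AddCommGroup L] [Module A L]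

theorem homogeneous_induction {P : ℕ → ExteriorAlgebra A L → Prop}
    (algebraMap : ∀ a, P 0 (algebraMap A _ a))
    (add : ∀ i x y, x ∈ ⋀[A]^i L → y ∈ ⋀[A]^i L → P i x → P i y → P i (x + y))
    (ι_mul : ∀ i x y, y ∈ ⋀[A]^i L → P i y → P (i + 1) (ι A x * y))
    {i : ℕ} {x : ExteriorAlgebra A L} (hx : x ∈ ⋀[A]^i L) : P i x :=
  Submodule.pow_induction_on_left' (LinearMap.range (ι A)) (C := fun i x _ => P i x) algebraMap
    (fun x y i hx hy => add i x y hx hy)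
    (fun m hm i x hx h => by obtain ⟨m, rfl⟩ := hm; exact ι_mul i m x hx h) hx

theorem algebraMap_mem_exteriorPower (a : A) : algebraMap A (ExteriorAlgebra A L) a ∈ ⋀[A]^0 L := by
  rw [exteriorPower, pow_zero]
  exact Submodule.algebraMap_mem a

theorem ι_mem_exteriorPower (x : L) : ι A x ∈ ⋀[A]^1 L := by
  rw [exteriorPower, pow_one]
  exact ⟨x, rfl⟩

theorem mul_mem_exteriorPower {i j k : ℕ} {x y : ExteriorAlgebra A L} (h : i + j = k)
    (hx : x ∈ ⋀[A]^i L) (hy : y ∈ ⋀[A]^j L) : x * y ∈ ⋀[A]^k L := by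
  subst h
  rw [exteriorPower, pow_add]
  exact Submodule.mul_mem_mul hx hy

variable {R : Type*} [CommRing R] [Algebra R A] [Module R L] [IsScalarTower R A L]

theorem mul_ι_comm {j : ℕ} {y : ExteriorAlgebra A L} (hy : y ∈ ⋀[A]^j L) (x : L) :
    y * ι A x = (-1 : R) ^ j • (ι A x * y) := by
  refine homogeneous_induction (P := fun j y => y * ι A x = (-1 : R) ^ j • (ι A x * y)) ?_ ?_ ?_ hy
  · intro a
    simp [Algebra.commutes]
  · intro i y z _ _ hy hz
    rw [add_mul, mul_add, smul_add, hy, hz]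
  · intro i m y _ h
    have hs : ι A m * ι A x = -(ι A x * ι A m) := eq_neg_of_add_eq_zero_left (ι_add_mul_swap m x)
    rw [mul_assoc, h, mul_smul_comm, ← mul_assoc, hs, pow_succ, ← mul_assoc]
    simp

theorem graded_mul_comm {i j : ℕ} {x y : ExteriorAlgebra A L}
    (hx : x ∈ ⋀[A]^i L) (hy : y ∈ ⋀[A]^j L) : x * y = (-1 : R) ^ (i * j) • (y * x) := by
  refine homogeneous_induction (P := fun i x => x * y = (-1 : R) ^ (i * j) • (y * x)) ?_ ?_ ?_ hx
  · intro a
    simp [Algebra.commutes]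
  · intro i w z _ _ hw hz
    rw [add_mul, mul_add, smul_add, hw, hz]
  · intro i m x _ h
    have hc : ι A m * y = (-1 : R) ^ j • (y * ι A m) := by
      rw [mul_ι_comm (R := R) hy, smul_smul, ← mul_pow]
      simp
    rw [mul_assoc, h, mul_smul_comm, ← mul_assoc, ← mul_assoc, hc, smul_mul_assoc, smul_smul,
      ← pow_add, add_mul, one_mul]

/-- No division by 2: cross terms of a sum cancel by anticommutation, and a product `ι m * y`
squares to zero because the two copies of `ι m` can be brought together. -/
theorem mul_self_eq_zero_of_odd {i : ℕ} {x : ExteriorAlgebra A L} (hi : Odd i)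
    (hx : x ∈ ⋀[A]^i L) : x * x = 0 := by
  refine homogeneous_induction (P := fun i x => Odd i → x * x = 0) ?_ ?_ ?_ hx hi
  · intro a h
    simp at h
  · intro i x y hx hy h h' hi
    have hc := graded_mul_comm (R := A) hx hy
    rw [Odd.neg_one_pow (hi.mul hi), neg_one_smul] at hc
    rw [add_mul, mul_add, mul_add, h hi, h' hi, hc]
    simp
  · intro i m y hy _ _
    have hc := mul_ι_comm (R := A) hy m
    rw [mul_assoc, ← mul_assoc y, hc, smul_mul_assoc, mul_smul_comm, mul_assoc, ← mul_assoc (ι A m),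
      ι_sq_zero, zero_mul, smul_zero]

end GradedCommutative

end ExteriorAlgebra

/-! ### The twist and the operators `[U,-]`. -/

namespace HomLieRinehart

open ExteriorAlgebra

variable {R : Type u} [CommRing R] (X : HomLieRinehart.{u, v} R)

theorem exists_extTwist (p : ℕ) : ∃ F : X.Ext →ₐ[R] X.Ext,
    (∀ a, F (algebraMap X.A X.Ext a) = algebraMap X.A X.Ext (X.φ a)) ∧
      ∀ x, F (ι X.A x) = (-1 : R) ^ p • ι X.A (X.α x) :=
  exists_semiLift ((IsScalarTower.toAlgHom R X.A X.Ext).comp X.φ)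
    ((-1 : R) ^ p • (ι X.A).restrictScalars R ∘ₗ X.α)
    (fun a x => by
      change (-1 : R) ^ p • ι X.A (X.α (a • x)) =
        algebraMap X.A X.Ext (X.φ a) * (-1 : R) ^ p • ι X.A (X.α x)
      rw [X.α_smul, map_smul, ← Algebra.smul_def, smul_comm])
    (fun a x => Algebra.commutes (X.φ a) _)
    (fun x => by simp)

/-- The algebra endomorphism `a X₁ ∧ ⋯ ∧ Xₙ ↦ (-1)^{pn} φ(a) α(X₁) ∧ ⋯ ∧ α(Xₙ)`. -/
noncomputable def extTwist (p : ℕ) : X.Ext →ₐ[R] X.Ext := (X.exists_extTwist p).choose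

/-- The algebra endomorphism `a X₁ ∧ ⋯ ∧ Xₙ ↦ φ(a) α(X₁) ∧ ⋯ ∧ α(Xₙ)`. -/
noncomputable def extα : X.Ext →ₐ[R] X.Ext := X.extTwist 0

variable {X}

@[simp]
theorem extTwist_algebraMap (p : ℕ) (a : X.A) :
    X.extTwist p (algebraMap X.A X.Ext a) = algebraMap X.A X.Ext (X.φ a) :=
  (X.exists_extTwist p).choose_spec.1 a

@[simp]
theorem extTwist_ι (p : ℕ) (x : X.L) :
    X.extTwist p (ι X.A x) = (-1 : R) ^ p • ι X.A (X.α x) :=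
  (X.exists_extTwist p).choose_spec.2 x

@[simp]
theorem extα_algebraMap (a : X.A) :
    X.extα (algebraMap X.A X.Ext a) = algebraMap X.A X.Ext (X.φ a) :=
  extTwist_algebraMap 0 a

@[simp]
theorem extα_ι (x : X.L) : X.extα (ι X.A x) = ι X.A (X.α x) := by
  simp [extα]

/-- Translates between the endomorphism, which also makes sense on inhomogeneous elements, and the
explicit sign in the graded Leibniz rule. -/
theorem extTwist_eq (p : ℕ) {j : ℕ} {Y : X.Ext} (hY : Y ∈ X.extGrading j) :
    X.extTwist p Y = (-1 : R) ^ (p * j) • X.extα Y := by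
  refine homogeneous_induction
    (P := fun j Y => X.extTwist p Y = (-1 : R) ^ (p * j) • X.extα Y) ?_ ?_ ?_ hY
  · intro a; simp
  · intro i x y _ _ hx hy
    rw [map_add, map_add, hx, hy, smul_add]
  · intro i x y _ hy
    rw [map_mul, map_mul, hy, extTwist_ι, extα_ι, smul_mul_smul_comm, ← pow_add, mul_add_one,
      add_comm]

theorem extα_mem {j : ℕ} {Y : X.Ext} (hY : Y ∈ X.extGrading j) : X.extα Y ∈ X.extGrading j := by
  refine homogeneous_induction (P := fun j Y => X.extα Y ∈ X.extGrading j) ?_ ?_ ?_ hY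
  · intro a
    rw [extα_algebraMap]
    exact algebraMap_mem_exteriorPower _
  · intro i x y _ _ hx hy
    rw [map_add]
    exact add_mem hx hy
  · intro i x y _ hy
    rw [map_mul, extα_ι]
    exact mul_mem_exteriorPower (add_comm _ _) (ι_mem_exteriorPower _) hy

variable (X)

theorem exists_adScalar : ∃ D : X.A →ₗ[R] X.Ext →ₗ[R] X.Ext,
    (∀ a b, D a (algebraMap X.A _ b) = 0) ∧
    (∀ a x, D a (ι X.A x) = -algebraMap X.A X.Ext (X.ρ x a)) ∧
    ∀ a Y Z, D a (Y * Z) = D a Y * X.extα Z + X.extTwist 1 Y * D a Z := by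
  refine exists_derivation_family (X.extTwist 1) X.extα 0
    (-(LinearMap.compr₂ X.ρ.flip (IsScalarTower.toAlgHom R X.A X.Ext).toLinearMap)) ?_ ?_ ?_ ?_
  · intro n a b
    simp
  · intro n a x
    simp [X.ρ_smul]
  · intro n a x
    simpa [X.ρ_smul] using Algebra.commutes (X.φ a) (algebraMap X.A X.Ext (X.ρ x n))
  · intro n x
    simp [← Algebra.commutes (X.ρ x n) (ι X.A (X.α x))]

/-- The operator `[a, -]` for `a ∈ A`. -/
noncomputable def adScalar : X.A →ₗ[R] X.Ext →ₗ[R] X.Ext := X.exists_adScalar.choose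

theorem exists_adVector : ∃ D : X.L →ₗ[R] X.Ext →ₗ[R] X.Ext,
    (∀ y b, D y (algebraMap X.A _ b) = algebraMap X.A X.Ext (X.ρ y b)) ∧
    (∀ y x, D y (ι X.A x) = ι X.A (X.bracket y x)) ∧
    ∀ y Y Z, D y (Y * Z) = D y Y * X.extα Z + X.extα Y * D y Z := by
  refine exists_derivation_family X.extα X.extα
    (LinearMap.compr₂ X.ρ (IsScalarTower.toAlgHom R X.A X.Ext).toLinearMap)
    (LinearMap.compr₂ X.bracket ((ι X.A).restrictScalars R)) ?_ ?_ ?_ ?_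
  · intro n a b
    simp [X.ρ_derivation n a b, ← map_mul, add_comm, mul_comm]
  · intro n a x
    simp [X.leibniz, Algebra.smul_def, add_comm]
  · intro n a x
    simp [X.leibniz, Algebra.smul_def, Algebra.commutes]
  · intro n x
    simp

/-- The operator `[y, -]` for `y ∈ L`. -/
noncomputable def adVector : X.L →ₗ[R] X.Ext →ₗ[R] X.Ext := X.exists_adVector.choose

variable {X}

@[simp]
theorem adScalar_algebraMap (a b : X.A) : X.adScalar a (algebraMap X.A X.Ext b) = 0 :=
  X.exists_adScalar.choose_spec.1 a b

@[simp]
theorem adScalar_ι (a : X.A) (x : X.L) :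
    X.adScalar a (ι X.A x) = -algebraMap X.A X.Ext (X.ρ x a) :=
  X.exists_adScalar.choose_spec.2.1 a x

theorem adScalar_mul (a : X.A) (Y Z : X.Ext) :
    X.adScalar a (Y * Z) = X.adScalar a Y * X.extα Z + X.extTwist 1 Y * X.adScalar a Z :=
  X.exists_adScalar.choose_spec.2.2 a Y Z

theorem adScalar_ι_mul (a : X.A) (x : X.L) (Z : X.Ext) :
    X.adScalar a (ι X.A x * Z) =
      -(algebraMap X.A X.Ext (X.ρ x a) * X.extα Z) - ι X.A (X.α x) * X.adScalar a Z := by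
  rw [adScalar_mul, adScalar_ι, extTwist_ι]
  simp [sub_eq_add_neg]

@[simp]
theorem adVector_algebraMap (y : X.L) (b : X.A) :
    X.adVector y (algebraMap X.A X.Ext b) = algebraMap X.A X.Ext (X.ρ y b) :=
  X.exists_adVector.choose_spec.1 y b

@[simp]
theorem adVector_ι (y x : X.L) : X.adVector y (ι X.A x) = ι X.A (X.bracket y x) :=
  X.exists_adVector.choose_spec.2.1 y x

theorem adVector_mul (y : X.L) (Y Z : X.Ext) :
    X.adVector y (Y * Z) = X.adVector y Y * X.extα Z + X.extα Y * X.adVector y Z :=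
  X.exists_adVector.choose_spec.2.2 y Y Z

theorem adVector_ι_mul (y x : X.L) (Z : X.Ext) :
    X.adVector y (ι X.A x * Z) =
      ι X.A (X.bracket y x) * X.extα Z + ι X.A (X.α x) * X.adVector y Z := by
  rw [adVector_mul, adVector_ι, extα_ι]

/-- This is the compatibility over `A` that allows `x ↦ -[x,U]` to be the restriction to `L` of a
derivation `[U,-]`. On a vector factor it is the Leibniz axiom moved to the first slot by
skew-symmetry. -/
theorem adVector_smul (a : X.A) (y : X.L) (Z : X.Ext) :
    X.adVector (a • y) Z =
      algebraMap X.A X.Ext (X.φ a) * X.adVector y Z + ι X.A (X.α y) * X.adScalar a Z := by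
  induction Z using CliffordAlgebra.left_induction with
  | algebraMap b => simp [X.ρ_smul]
  | add Z W hZ hW => simp only [map_add, hZ, hW, mul_add]; abel
  | ι_mul Z x h =>
    have hb : X.bracket (a • y) x = X.φ a • X.bracket y x - X.ρ x a • X.α y := by
      rw [X.isHomLie.skew, X.leibniz, X.isHomLie.skew x y, smul_neg]
      abel
    have hs : ι X.A (X.α x) * ι X.A (X.α y) = -(ι X.A (X.α y) * ι X.A (X.α x)) :=
      eq_neg_of_add_eq_zero_left (ι_add_mul_swap _ _)
    rw [adVector_ι_mul, adVector_ι_mul, adScalar_ι_mul, h, hb, map_sub, map_smul, map_smul,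
      Algebra.smul_def, Algebra.smul_def]
    simp only [sub_mul, mul_add, mul_sub, mul_neg, ← mul_assoc, hs, neg_mul,
      ← Algebra.commutes (X.φ a) (ι X.A (X.α x)), Algebra.commutes (X.ρ x a) (ι X.A (X.α y))]
    abel

variable (X)

/-- The component of degree `d - 1`. -/
def shiftedGrading : ℕ → Submodule R X.Ext
  | 0 => ⊥
  | d + 1 => X.extGrading d

variable {X}

theorem mul_mem_shiftedGrading {i j d : ℕ} (h : i + j = d) {x y : X.Ext}
    (hx : x ∈ X.shiftedGrading i) (hy : y ∈ X.extGrading j) : x * y ∈ X.shiftedGrading d := by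
  subst h
  cases i with
  | zero =>
    rw [shiftedGrading, Submodule.mem_bot] at hx
    rw [hx, zero_mul]
    exact zero_mem _
  | succ i =>
    rw [add_right_comm]
    exact mul_mem_exteriorPower rfl hx hy

/-- Index `i` stands for degree `i - 1`, and `i + 1` has the same parity. -/
theorem graded_mul_comm_shifted {i j : ℕ} {x y : X.Ext}
    (hx : x ∈ X.shiftedGrading i) (hy : y ∈ X.extGrading j) :
    x * y = (-1 : R) ^ ((i + 1) * j) • (y * x) := by
  cases i with
  | zero =>
    rw [shiftedGrading, Submodule.mem_bot] at hx
    simp [hx]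
  | succ i =>
    rw [graded_mul_comm (R := R) hx hy]
    congr 1
    exact neg_one_pow_eq_of_zmod_two (by
      push_cast; generalize (i : ZMod 2) = i; generalize (j : ZMod 2) = j; decide +revert)

theorem mul_mem_shiftedGrading' {i j d : ℕ} (h : j + i = d) {x y : X.Ext}
    (hx : x ∈ X.shiftedGrading i) (hy : y ∈ X.extGrading j) : y * x ∈ X.shiftedGrading d := by
  have h1 := graded_mul_comm_shifted hx hy
  have h2 : y * x = (-1 : R) ^ ((i + 1) * j) • (x * y) := by
    rw [h1, smul_smul, ← mul_pow]; simp
  rw [h2]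
  exact Submodule.smul_mem _ _ (mul_mem_shiftedGrading (by omega) hx hy)

theorem adScalar_mem (a : X.A) {j : ℕ} {Y : X.Ext} (hY : Y ∈ X.extGrading j) :
    X.adScalar a Y ∈ X.shiftedGrading j := by
  refine homogeneous_induction (P := fun j Y => X.adScalar a Y ∈ X.shiftedGrading j) ?_ ?_ ?_ hY
  · intro b
    rw [adScalar_algebraMap]
    exact zero_mem _
  · intro i x y _ _ hx hy
    rw [map_add]
    exact add_mem hx hy
  · intro i x Z hZ h
    rw [adScalar_ι_mul]
    exact sub_mem (neg_mem (mul_mem_exteriorPower (zero_add _) (algebraMap_mem_exteriorPower _)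
      (extα_mem hZ))) (mul_mem_shiftedGrading' (add_comm _ _) h (ι_mem_exteriorPower _))

theorem adVector_mem (y : X.L) {j : ℕ} {Y : X.Ext} (hY : Y ∈ X.extGrading j) :
    X.adVector y Y ∈ X.extGrading j := by
  refine homogeneous_induction (P := fun j Y => X.adVector y Y ∈ X.extGrading j) ?_ ?_ ?_ hY
  · intro b
    rw [adVector_algebraMap]
    exact algebraMap_mem_exteriorPower _
  · intro i x y _ _ hx hy
    rw [map_add]
    exact add_mem hx hy
  · intro i x Z hZ h
    rw [adVector_ι_mul]
    exact add_mem (mul_mem_exteriorPower (add_comm _ _) (ι_mem_exteriorPower _)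
      (extα_mem hZ)) (mul_mem_exteriorPower (add_comm _ _) (ι_mem_exteriorPower _) h)

/-- The values on generators are those forced by skew-symmetry: `-(-1)^((n+1)(0+1)) = (-1)^n` and
`-(-1)^((n+1)(1+1)) = -1`. The degree is fixed because the sign in the Leibniz rule depends on it.
-/
theorem exists_adHomogeneous (X : HomLieRinehart.{u, v} R) (n : ℕ) :
    ∃ D : X.extGrading n →ₗ[R] X.Ext →ₗ[R] X.Ext,
      (∀ Y a, D Y (algebraMap X.A _ a) = (-1 : R) ^ n • X.adScalar a Y) ∧
      (∀ Y x, D Y (ι X.A x) = -X.adVector x Y) ∧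
      ∀ Y Z W, D Y (Z * W) = D Y Z * X.extα W + X.extTwist (n + 1) Z * D Y W := by
  have hcomm : ∀ (Y : X.extGrading n) (a : X.A) (x : X.L),
      X.adScalar a (Y : X.Ext) * ι X.A x =
        (-1 : R) ^ (n + 1) • (ι X.A x * X.adScalar a (Y : X.Ext)) := fun Y a x => by
    rw [graded_mul_comm_shifted (adScalar_mem a Y.2) (j := 1)
      (y := ι X.A x) (ι_mem_exteriorPower x), mul_one]
  have hsmul : ∀ (a b : X.A) (Y : X.Ext), X.adScalar (a * b) Y =
      algebraMap X.A X.Ext (X.φ a) * X.adScalar b Y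
        + algebraMap X.A X.Ext (X.φ b) * X.adScalar a Y := fun a b Y => by
    induction Y using CliffordAlgebra.left_induction with
    | algebraMap b => simp
    | add Z W hZ hW => simp only [map_add, hZ, hW, mul_add]; abel
    | ι_mul Z x h =>
      simp only [adScalar_ι_mul, h, X.ρ_derivation x a b, map_add, map_mul, mul_add, mul_sub,
        mul_neg, add_mul, ← mul_assoc, ← Algebra.commutes _ (ι X.A (X.α x))]
      abel
  refine exists_derivation_family (X.extTwist (n + 1)) X.extα
    ((-1 : R) ^ n • X.adScalar.flip ∘ₗ (X.extGrading n).subtype)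
    (-(X.adVector.flip ∘ₗ (X.extGrading n).subtype)) ?_ ?_ ?_ ?_
  · intro Y a b
    simp only [LinearMap.smul_apply, LinearMap.comp_apply, Submodule.subtype_apply,
      LinearMap.flip_apply, extα_algebraMap, extTwist_algebraMap, hsmul, smul_mul_assoc,
      mul_smul_comm, ← Algebra.commutes (X.φ b) (X.adScalar a (Y : X.Ext)), smul_add]
    abel
  · intro Y a x
    simp only [LinearMap.smul_apply, LinearMap.comp_apply, Submodule.subtype_apply,
      LinearMap.flip_apply, extα_ι, extTwist_algebraMap, LinearMap.neg_apply, adVector_smul,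
      smul_mul_assoc, hcomm, smul_smul, ← pow_add]
    -- The exponent is `n + (n + 1)`: the prefactor of `[U,a]` and the sign from moving a vector
    -- past the degree `n - 1` element `[a,U]`.
    rw [Odd.neg_one_pow (by grind)]
    simp only [neg_smul, one_smul, mul_neg]
    abel
  · intro Y a x
    simp only [LinearMap.smul_apply, LinearMap.comp_apply, Submodule.subtype_apply,
      LinearMap.flip_apply, extα_algebraMap, extTwist_ι, LinearMap.neg_apply, adVector_smul,
      smul_mul_smul_comm, ← pow_add]
    rw [Odd.neg_one_pow (by grind)]
    simp only [neg_smul, one_smul, neg_mul, Algebra.commutes]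
    abel
  · intro Y x
    simp only [LinearMap.comp_apply, Submodule.subtype_apply,
      LinearMap.flip_apply, extα_ι, extTwist_ι, LinearMap.neg_apply, neg_mul, mul_neg,
      smul_mul_assoc]
    rw [mul_ι_comm (R := R) (adVector_mem x Y.2), pow_succ]
    simp

end HomLieRinehart

/-! ### The bracket: degree, skew-symmetry and multiplicativity of the twist. -/

namespace HomLieRinehart

open ExteriorAlgebra

variable {R : Type u} [CommRing R] (X : HomLieRinehart.{u, v} R)

/-- The twisted Schouten bracket on `∧*_A L`. -/
noncomputable def extBracket : X.Ext →ₗ[R] X.Ext →ₗ[R] X.Ext :=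
  DirectSum.toModule R ℕ _ (fun n => (exists_adHomogeneous X n).choose) ∘ₗ
    (DirectSum.decomposeLinearEquiv X.extGrading).toLinearMap

variable {X}

theorem extBracket_eq {n : ℕ} {U : X.Ext} (hU : U ∈ X.extGrading n) :
    X.extBracket U = (exists_adHomogeneous X n).choose ⟨U, hU⟩ := by
  rw [extBracket, LinearMap.comp_apply, LinearEquiv.coe_coe,
    DirectSum.decomposeLinearEquiv_apply, DirectSum.decompose_of_mem _ hU]
  exact DirectSum.toModule_lof R n _

theorem algebraMap_mem (a : X.A) : algebraMap X.A X.Ext a ∈ X.extGrading 0 :=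
  algebraMap_mem_exteriorPower a

theorem ι_mem (x : X.L) : ι X.A x ∈ X.extGrading 1 :=
  ι_mem_exteriorPower x

theorem extBracket_algebraMap_right {n : ℕ} {U : X.Ext} (hU : U ∈ X.extGrading n) (a : X.A) :
    X.extBracket U (algebraMap X.A X.Ext a) = (-1 : R) ^ n • X.adScalar a U := by
  rw [extBracket_eq hU]
  exact (exists_adHomogeneous X n).choose_spec.1 _ _

theorem extBracket_ι_right {n : ℕ} {U : X.Ext} (hU : U ∈ X.extGrading n) (x : X.L) :
    X.extBracket U (ι X.A x) = -X.adVector x U := by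
  rw [extBracket_eq hU]
  exact (exists_adHomogeneous X n).choose_spec.2.1 _ _

theorem extBracket_mul_right {n : ℕ} {U : X.Ext} (hU : U ∈ X.extGrading n) (V W : X.Ext) :
    X.extBracket U (V * W) =
      X.extBracket U V * X.extα W + X.extTwist (n + 1) V * X.extBracket U W := by
  rw [extBracket_eq hU]
  exact (exists_adHomogeneous X n).choose_spec.2.2 _ _ _

theorem extBracket_mul_right' {n j : ℕ} {U V : X.Ext} (hU : U ∈ X.extGrading n)
    (hV : V ∈ X.extGrading j) (W : X.Ext) :
    X.extBracket U (V * W) = X.extBracket U V * X.extα W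
      + (-1 : R) ^ ((n + 1) * j) • (X.extα V * X.extBracket U W) := by
  rw [extBracket_mul_right hU, extTwist_eq _ hV, smul_mul_assoc]

theorem extBracket_ι_mul_right {n : ℕ} {U : X.Ext} (hU : U ∈ X.extGrading n) (x : X.L)
    (W : X.Ext) :
    X.extBracket U (ι X.A x * W) = X.extBracket U (ι X.A x) * X.extα W
      + (-1 : R) ^ (n + 1) • (ι X.A (X.α x) * X.extBracket U W) := by
  rw [extBracket_mul_right' hU (ι_mem x), mul_one, extα_ι]

/-- Consistency of the two rounds of the construction: both sides obey the same Leibniz rule and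
agree on generators. -/
theorem extBracket_algebraMap_left (a : X.A) :
    X.extBracket (algebraMap X.A X.Ext a) = X.adScalar a := by
  refine linearMap_ext_left (fun b => ?_) (fun x W h => ?_)
  · simp [extBracket_algebraMap_right (algebraMap_mem a)]
  · rw [extBracket_ι_mul_right (algebraMap_mem a), extBracket_ι_right (algebraMap_mem a),
      adVector_algebraMap, adScalar_ι_mul, h]
    simp [sub_eq_add_neg]

theorem extBracket_ι_left (x : X.L) : X.extBracket (ι X.A x) = X.adVector x := by
  refine linearMap_ext_left (fun b => ?_) (fun y W h => ?_)
  · simp [extBracket_algebraMap_right (ι_mem x)]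
  · rw [extBracket_ι_mul_right (ι_mem x), extBracket_ι_right (ι_mem x),
      adVector_ι, adVector_ι_mul, h, X.isHomLie.skew y x]
    simp

theorem extBracket_mem {i j : ℕ} {U V : X.Ext} (hU : U ∈ X.extGrading i)
    (hV : V ∈ X.extGrading j) : X.extBracket U V ∈ X.shiftedGrading (i + j) := by
  refine homogeneous_induction (P := fun j V => X.extBracket U V ∈ X.shiftedGrading (i + j))
    ?_ ?_ ?_ hV
  · intro a
    rw [extBracket_algebraMap_right hU]
    exact Submodule.smul_mem _ _ (adScalar_mem a hU)
  · intro k V W _ _ hV hW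
    rw [map_add]
    exact add_mem hV hW
  · intro k x W hW h
    rw [extBracket_ι_mul_right hU, extBracket_ι_right hU]
    refine add_mem (mul_mem_shiftedGrading (i := i + 1) (j := k) (by ring)
      (neg_mem (adVector_mem x hU)) (extα_mem hW)) (Submodule.smul_mem _ _
      (mul_mem_shiftedGrading' (j := 1) (i := i + k) (by ring) h (ι_mem _)))

theorem extBracket_ι_mul_right_shifted {d : ℕ} {U : X.Ext} (hU : U ∈ X.shiftedGrading d) (x : X.L)
    (W : X.Ext) :
    X.extBracket U (ι X.A x * W) = X.extBracket U (ι X.A x) * X.extα W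
      + (-1 : R) ^ d • (ι X.A (X.α x) * X.extBracket U W) := by
  cases d with
  | zero =>
    rw [shiftedGrading, Submodule.mem_bot] at hU
    simp [hU]
  | succ d => exact extBracket_ι_mul_right hU x W

/-- The first slot has no Leibniz rule by construction. Induction on `Z` derives this one from the
rule in the second slot, and it drives the induction in `extBracket_skew`. -/
theorem extBracket_ι_mul_left {j : ℕ} {Y : X.Ext} (hY : Y ∈ X.extGrading j) (x : X.L) (Z : X.Ext) :
    X.extBracket (ι X.A x * Y) Z = ι X.A (X.α x) * X.extBracket Y Z
      + (-1 : R) ^ j • (X.extα Y * X.adVector x Z) := by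
  have hxY : ι X.A x * Y ∈ X.extGrading (j + 1) := mul_mem_exteriorPower (add_comm _ _) (ι_mem x) hY
  have hs : ((-1 : R) ^ j) * (-1) ^ j = 1 := by rw [← mul_pow]; simp
  induction Z using CliffordAlgebra.left_induction with
  | algebraMap a =>
    rw [extBracket_algebraMap_right hxY, extBracket_algebraMap_right hY, adScalar_ι_mul,
      adVector_algebraMap, pow_succ, ← Algebra.commutes, mul_smul_comm, ← smul_add, mul_neg_one,
      neg_smul, ← smul_neg]
    congr 1
    abel
  | add Z W hZ hW => simp only [map_add, hZ, hW, mul_add, smul_add]; abel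
  | ι_mul W z h =>
    have h1 := mul_ι_comm (R := R) (extα_mem hY) (X.bracket x z)
    have h2 := mul_ι_comm (R := R) (extα_mem hY) (X.α z)
    have h3 : ι X.A (X.α x) * ι X.A (X.α z) = -(ι X.A (X.α z) * ι X.A (X.α x)) :=
      eq_neg_of_add_eq_zero_left (ι_add_mul_swap _ _)
    rw [extBracket_ι_mul_right hxY, extBracket_ι_mul_right hY, h, extBracket_ι_right hxY,
      extBracket_ι_right hY, adVector_ι_mul, adVector_ι_mul, X.isHomLie.skew z x]
    simp only [mul_add, add_mul, smul_add, mul_smul_comm, smul_mul_assoc, ← mul_assoc, h1, h2, h3,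
      map_neg, neg_mul, mul_neg, neg_neg, neg_add, smul_smul, pow_succ, mul_one, neg_smul, smul_neg,
      hs, one_smul]
    abel

theorem extBracket_skew {i j : ℕ} {U V : X.Ext} (hU : U ∈ X.extGrading i)
    (hV : V ∈ X.extGrading j) :
    X.extBracket U V = -((-1 : R) ^ ((i + 1) * (j + 1)) • X.extBracket V U) := by
  refine homogeneous_induction (P := fun j V =>
    X.extBracket U V = -((-1 : R) ^ ((i + 1) * (j + 1)) • X.extBracket V U)) ?_ ?_ ?_ hV
  · intro a
    rw [extBracket_algebraMap_right hU, extBracket_algebraMap_left]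
    simp [pow_succ]
  · intro k V W _ _ hV hW
    simp only [map_add, hV, hW, LinearMap.add_apply, smul_add, neg_add]
  · intro k x W hW h
    rw [extBracket_ι_mul_right hU, extBracket_ι_mul_left hW, extBracket_ι_right hU, h,
      graded_mul_comm (R := R) (extα_mem hW) (adVector_mem x hU)]
    simp only [smul_add, smul_smul, mul_smul_comm, mul_neg, smul_neg, neg_add, neg_mul, ← pow_add]
    have h1 : (-1 : R) ^ (i + 1 + (i + 1) * (k + 1)) = (-1) ^ ((i + 1) * (k + 1 + 1)) := by
      congr 1; ring
    have h2 : (-1 : R) ^ ((i + 1) * (k + 1 + 1) + (k + k * i)) = 1 :=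
      Even.neg_one_pow ⟨(i + 1) * (k + 1), by ring⟩
    rw [h1, h2, one_smul, add_comm]

theorem extα_adScalar (a : X.A) (U : X.Ext) :
    X.extα (X.adScalar a U) = X.adScalar (X.φ a) (X.extα U) := by
  induction U using CliffordAlgebra.left_induction with
  | algebraMap b => simp
  | add Z W hZ hW => simp only [map_add, hZ, hW]
  | ι_mul W z h =>
    have hr := LinearMap.congr_fun (X.isRep.comm z) a
    simp only [LinearMap.comp_apply, AlgHom.toLinearMap_apply] at hr
    simp only [map_mul, extα_ι, adScalar_ι_mul, map_sub, map_neg, extα_algebraMap, h, hr]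

theorem extα_adVector (x : X.L) (U : X.Ext) :
    X.extα (X.adVector x U) = X.adVector (X.α x) (X.extα U) := by
  induction U using CliffordAlgebra.left_induction with
  | algebraMap a =>
    have hr := LinearMap.congr_fun (X.isRep.comm x) a
    simp only [LinearMap.comp_apply, AlgHom.toLinearMap_apply] at hr
    simp [hr]
  | add Z W hZ hW => simp only [map_add, hZ, hW]
  | ι_mul W z h =>
    simp only [map_mul, extα_ι, adVector_ι_mul, map_add, h, X.isHomLie.map_bracket]

theorem extα_extBracket (U V : X.Ext) :
    X.extα (X.extBracket U V) = X.extBracket (X.extα U) (X.extα V) := by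
  induction U using DirectSum.Decomposition.inductionOn X.extGrading with
  | zero => simp
  | add U U' h h' => simp only [map_add, LinearMap.add_apply, h, h']
  | @homogeneous i U =>
    induction V using CliffordAlgebra.left_induction with
    | algebraMap a =>
      rw [extα_algebraMap, extBracket_algebraMap_right U.2,
        extBracket_algebraMap_right (extα_mem U.2), map_smul, extα_adScalar]
    | add Z W hZ hW => simp only [map_add, hZ, hW]
    | ι_mul W z h =>
      rw [map_mul X.extα, extα_ι, extBracket_ι_mul_right U.2, extBracket_ι_mul_right (extα_mem U.2),
        extBracket_ι_right U.2, extBracket_ι_right (extα_mem U.2)]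
      simp only [map_add, map_smul, map_mul, map_neg, extα_adVector, h, extα_ι]

/-! ### The hom-Jacobi identity. -/

variable (X) in
/-- The hom-Jacobi identity, as a statement on the commutator of `[U, -]` and `[V, -]`. -/
def JacobiAt (i j : ℕ) (U V Z : X.Ext) : Prop :=
  X.extBracket (X.extα U) (X.extBracket V Z)
    - (-1 : R) ^ ((i + 1) * (j + 1)) • X.extBracket (X.extα V) (X.extBracket U Z)
    = X.extBracket (X.extBracket U V) (X.extα Z)

theorem extBracket_skew_shifted {i j : ℕ} {U V : X.Ext} (hU : U ∈ X.extGrading i)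
    (hV : V ∈ X.shiftedGrading j) :
    X.extBracket U V = -((-1 : R) ^ ((i + 1) * j) • X.extBracket V U) := by
  cases j with
  | zero =>
    rw [shiftedGrading, Submodule.mem_bot] at hV
    simp [hV]
  | succ j => exact extBracket_skew hU hV

theorem jacobiAt_iff {i j k : ℕ} {U V Z : X.Ext} (hU : U ∈ X.extGrading i)
    (hV : V ∈ X.extGrading j) (hZ : Z ∈ X.extGrading k) :
    X.JacobiAt i j U V Z ↔
      (-1 : R) ^ ((i + 1) * (k + 1)) • X.extBracket (X.extα U) (X.extBracket V Z)
        + (-1 : R) ^ ((j + 1) * (i + 1)) • X.extBracket (X.extα V) (X.extBracket Z U)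
        + (-1 : R) ^ ((k + 1) * (j + 1)) • X.extBracket (X.extα Z) (X.extBracket U V) = 0 := by
  have hs : ((-1 : R) ^ ((i + 1) * (k + 1))) * (-1) ^ ((i + 1) * (k + 1)) = 1 := by
    rw [← mul_pow]; simp
  -- The summand `(k+1)(i+j)` comes from exchanging `α Z` with `[U,V]`, which has degree `i + j -
  -- 1`. Modulo 2 the identity is a finite check.
  have h3 : (-1 : R) ^ ((k + 1) * (j + 1) + (k + 1) * (i + j)) = (-1) ^ ((i + 1) * (k + 1)) :=
    neg_one_pow_eq_of_zmod_two (by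
      push_cast; generalize (i : ZMod 2) = i; generalize (j : ZMod 2) = j
      generalize (k : ZMod 2) = k; decide +revert)
  rw [extBracket_skew hZ hU, extBracket_skew_shifted (extα_mem hZ) (extBracket_mem hU hV),
    JacobiAt, mul_comm (j + 1), mul_comm (k + 1) (i + 1)]
  simp only [map_neg, map_smul, smul_neg, smul_smul, ← pow_add]
  rw [h3, add_comm ((i + 1) * (j + 1)), pow_add, mul_smul, ← smul_neg, ← smul_add,
    ← sub_eq_add_neg, ← smul_sub, ← sub_eq_add_neg, ← sub_eq_zero]
  refine ⟨fun h => by rw [h, smul_zero], fun h => ?_⟩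
  have := congrArg (fun w => (-1 : R) ^ ((i + 1) * (k + 1)) • w) h
  simpa only [smul_smul, hs, one_smul, smul_zero] using this

theorem JacobiAt.rotate {i j k : ℕ} {U V Z : X.Ext} (hU : U ∈ X.extGrading i)
    (hV : V ∈ X.extGrading j) (hZ : Z ∈ X.extGrading k) (h : X.JacobiAt i j U V Z) :
    X.JacobiAt j k V Z U := by
  rw [jacobiAt_iff hU hV hZ] at h
  rw [jacobiAt_iff hV hZ hU, ← h]
  abel

/-- Expanding at `ι z * W` leaves the identities at `z` and at `W` plus cross terms such as `α[V,z]
· [αU,αW]`. These cancel in pairs because `α[V,z] = [αV,αz]`, and likewise for the others. -/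
theorem jacobiAt_of_generators {i j : ℕ} {U V : X.Ext} (hU : U ∈ X.extGrading i)
    (hV : V ∈ X.extGrading j) (h₀ : ∀ a, X.JacobiAt i j U V (algebraMap X.A X.Ext a))
    (h₁ : ∀ x, X.JacobiAt i j U V (ι X.A x)) (Z : X.Ext) : X.JacobiAt i j U V Z := by
  induction Z using CliffordAlgebra.left_induction with
  | algebraMap a => exact h₀ a
  | add Z W hZ hW =>
    unfold JacobiAt at *
    simp only [map_add, smul_add, ← hZ, ← hW]
    abel
  | ι_mul W z h =>
    have hz := h₁ z
    unfold JacobiAt at *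
    have hUz : X.extBracket U (ι X.A z) ∈ X.extGrading i := extBracket_mem hU (ι_mem z)
    have hVz : X.extBracket V (ι X.A z) ∈ X.extGrading j := extBracket_mem hV (ι_mem z)
    rw [map_mul X.extα, extα_ι, extBracket_ι_mul_right_shifted (extBracket_mem hU hV), ← h, ← extα_ι, ← hz,
      extBracket_ι_mul_right hU, extBracket_ι_mul_right hV]
    simp only [map_add, map_smul]
    rw [extBracket_mul_right' (extα_mem hU) hVz, extBracket_mul_right' (extα_mem hV) hUz,
      extBracket_ι_mul_right (extα_mem hU), extBracket_ι_mul_right (extα_mem hV)]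
    simp only [extα_extBracket, extα_ι, mul_sub, sub_mul, smul_add, smul_sub, smul_smul,
      mul_smul_comm, smul_mul_assoc, ← pow_add]
    -- The signs depend only on the parities of `i` and `j`.
    rcases Nat.even_or_odd i with hi | hi <;> rcases Nat.even_or_odd j with hj | hj <;>
      · simp only [pow_add, add_mul, mul_add, pow_mul, hi.neg_one_pow, hj.neg_one_pow, one_pow,
          mul_one, one_mul, pow_one, neg_smul, one_smul, neg_neg, mul_neg]
        abel

theorem jacobiAt_algebraMap_algebraMap (a b : X.A) (Z : X.Ext) :
    X.JacobiAt 0 0 (algebraMap X.A X.Ext a) (algebraMap X.A X.Ext b) Z := by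
  refine jacobiAt_of_generators (algebraMap_mem a) (algebraMap_mem b) (fun c => ?_) (fun x => ?_) Z
  · simp [JacobiAt, extBracket_algebraMap_left]
  · simp [JacobiAt, extBracket_algebraMap_left]

theorem jacobiAt_ι_algebraMap (x : X.L) (b : X.A) (Z : X.Ext) :
    X.JacobiAt 1 0 (ι X.A x) (algebraMap X.A X.Ext b) Z := by
  refine jacobiAt_of_generators (ι_mem x) (algebraMap_mem b) (fun c => ?_) (fun y => ?_) Z
  · simp [JacobiAt, extBracket_algebraMap_left, extBracket_ι_left]
  · have hr := LinearMap.congr_fun (X.isRep.bracket x y) b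
    simp only [LinearMap.comp_apply, AlgHom.toLinearMap_apply, LinearMap.sub_apply] at hr
    simp [JacobiAt, extBracket_algebraMap_left, extBracket_ι_left, hr]
    abel

theorem jacobiAt_ι_ι (x y : X.L) (Z : X.Ext) :
    X.JacobiAt 1 1 (ι X.A x) (ι X.A y) Z := by
  refine jacobiAt_of_generators (ι_mem x) (ι_mem y) (fun b => ?_) (fun z => ?_) Z
  · have hr := LinearMap.congr_fun (X.isRep.bracket x y) b
    simp only [LinearMap.comp_apply, AlgHom.toLinearMap_apply, LinearMap.sub_apply] at hr
    simp [JacobiAt, extBracket_ι_left, hr, show (-1 : R) ^ 4 = 1 by norm_num]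
  · have h := X.isHomLie.jacobi x y z
    rw [X.isHomLie.skew (X.α z), X.isHomLie.skew z x, map_neg] at h
    have h' : X.bracket (X.α x) (X.bracket y z) - X.bracket (X.α y) (X.bracket x z) =
        X.bracket (X.bracket x y) (X.α z) := by
      rw [← sub_eq_zero, ← h]; abel
    simp [JacobiAt, extBracket_ι_left, ← h', show (-1 : R) ^ 4 = 1 by norm_num]

/-- Only generators `Z` matter. Rotating such a `Z` to the front gives a case with two generators
and `V` in the free third slot. The next two lemmas repeat the device. -/
theorem jacobiAt_algebraMap (a : X.A) {j : ℕ} {V : X.Ext} (hV : V ∈ X.extGrading j) (Z : X.Ext) :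
    X.JacobiAt 0 j (algebraMap X.A X.Ext a) V Z := by
  have ha := algebraMap_mem a
  refine jacobiAt_of_generators ha hV (fun b => ?_) (fun x => ?_) Z
  · exact (jacobiAt_algebraMap_algebraMap b a V).rotate (algebraMap_mem b) ha hV
  · exact (jacobiAt_ι_algebraMap x a V).rotate (ι_mem x) ha hV

theorem jacobiAt_ι (x : X.L) {j : ℕ} {V : X.Ext} (hV : V ∈ X.extGrading j) (Z : X.Ext) :
    X.JacobiAt 1 j (ι X.A x) V Z := by
  have hx := ι_mem x
  refine jacobiAt_of_generators hx hV (fun b => ?_) (fun y => ?_) Z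
  · have hb := algebraMap_mem b
    exact (jacobiAt_algebraMap b hx V).rotate hb hx hV
  · exact (jacobiAt_ι_ι y x V).rotate (ι_mem y) hx hV

theorem jacobiAt {i j : ℕ} {U V : X.Ext} (hU : U ∈ X.extGrading i) (hV : V ∈ X.extGrading j)
    (Z : X.Ext) : X.JacobiAt i j U V Z := by
  refine jacobiAt_of_generators hU hV (fun a => ?_) (fun x => ?_) Z
  · exact (jacobiAt_algebraMap a hU V).rotate (algebraMap_mem a) hU hV
  · exact (jacobiAt_ι x hU V).rotate (ι_mem x) hU hV

variable (X)

/-- The hom-Gerstenhaber structure on `∧*_A L`. -/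
noncomputable def extStructure : HomGerstenhaberStructure R X.extGrading where
  bracket := X.extBracket
  α := X.extα
  mul_comm _ _ _ _ hx hy := graded_mul_comm hx hy
  mul_self _ _ hi hx := mul_self_eq_zero_of_odd hi hx
  α_mem _ _ hx := extα_mem hx
  bracket_mem i j k x y h hx hy := by
    have := extBracket_mem hx hy
    rwa [h] at this
  -- Index `0 + 0` of the shifted grading is degree `-1`, which is `⊥`.
  bracket_zero_zero x y hx hy := (Submodule.mem_bot R).1 (extBracket_mem hx hy)
  skew _ _ _ _ hx hy := extBracket_skew hx hy
  map_bracket := extα_extBracket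
  jacobi _ _ _ _ _ z hx hy hz := (jacobiAt_iff hx hy hz).1 (jacobiAt hx hy z)
  leibniz _ _ _ _ _ z hx hy _ := extBracket_mul_right' hx hy z

end HomLieRinehart

namespace HomLieRinehart

open ExteriorAlgebra

variable {R : Type u} [CommRing R] {X : HomLieRinehart.{u, v} R}

/-! ### The Schouten formulas -/

theorem extα_ιMulti {n : ℕ} (x : Fin n → X.L) :
    X.extα (ιMulti X.A n x) = ιMulti X.A n (fun i => X.α (x i)) := by
  induction n with
  | zero => simp
  | succ n ih =>
    rw [ιMulti_succ_apply, map_mul, extα_ι, ιMulti_succ_apply]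
    congr 1
    exact ih _

theorem ιMulti_mem {n : ℕ} (x : Fin n → X.L) : ιMulti X.A n x ∈ X.extGrading n :=
  ιMulti_range X.A n ⟨x, rfl⟩

theorem vecTail_succ_removeNth {n : ℕ} {L : Type*} (x : Fin (n + 2) → L) (i : Fin (n + 1)) :
    i.succ.removeNth x 0 = x 0 ∧
      Matrix.vecTail (i.succ.removeNth x) = i.removeNth (Matrix.vecTail x) := by
  refine ⟨by simp [Fin.removeNth], ?_⟩
  ext j
  simp [Fin.removeNth, Matrix.vecTail]

theorem ιMulti_removeNth_succ {n : ℕ} (x : Fin (n + 2) → X.L) (i : Fin (n + 1)) :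
    ιMulti X.A (n + 1) (i.succ.removeNth x) =
      ι X.A (x 0) * ιMulti X.A n (i.removeNth (Matrix.vecTail x)) := by
  rw [ιMulti_succ_apply, (vecTail_succ_removeNth x i).1, (vecTail_succ_removeNth x i).2]

theorem ιMulti_removeNth_zero {n : ℕ} (x : Fin (n + 1) → X.L) :
    ιMulti X.A n ((0 : Fin (n + 1)).removeNth x) = ιMulti X.A n (Matrix.vecTail x) := by
  congr 1

theorem adScalar_ιMulti (a : X.A) {n : ℕ} (x : Fin (n + 1) → X.L) :
    X.adScalar a (ιMulti X.A (n + 1) x) =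
      ∑ i : Fin (n + 1), -((-1 : R) ^ (i : ℕ) •
        (algebraMap X.A X.Ext (X.ρ (x i) a) * X.extα (ιMulti X.A n (i.removeNth x)))) := by
  induction n with
  | zero => simp [ιMulti_succ_apply]
  | succ n ih =>
    rw [ιMulti_succ_apply, adScalar_ι_mul, ih, Fin.sum_univ_succ (n := n + 1), ιMulti_removeNth_zero,
      sub_eq_add_neg, Finset.mul_sum, ← Finset.sum_neg_distrib]
    congr 1
    · simp
    · refine Finset.sum_congr rfl fun i _ => ?_
      rw [ιMulti_removeNth_succ, map_mul, extα_ι, ← mul_assoc (algebraMap _ _ _) (ι X.A _),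
        Algebra.commutes _ (ι X.A _), Fin.val_succ,
        pow_succ, mul_neg_one, neg_smul, mul_neg, mul_smul_comm, mul_assoc]
      rfl

theorem adVector_ιMulti (y : X.L) {n : ℕ} (x : Fin (n + 1) → X.L) :
    X.adVector y (ιMulti X.A (n + 1) x) =
      ∑ i : Fin (n + 1), (-1 : R) ^ (i : ℕ) •
        (ι X.A (X.bracket y (x i)) * X.extα (ιMulti X.A n (i.removeNth x))) := by
  induction n with
  | zero => simp [ιMulti_succ_apply]
  | succ n ih =>
    rw [ιMulti_succ_apply, adVector_ι_mul, ih, Fin.sum_univ_succ (n := n + 1), ιMulti_removeNth_zero,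
      Finset.mul_sum]
    congr 1
    · simp
    · refine Finset.sum_congr rfl fun i _ => ?_
      have hs : ι X.A (X.bracket y (x i.succ)) * ι X.A (X.α (x 0)) =
          -(ι X.A (X.α (x 0)) * ι X.A (X.bracket y (x i.succ))) :=
        eq_neg_of_add_eq_zero_left (ι_add_mul_swap _ _)
      rw [ιMulti_removeNth_succ, map_mul, extα_ι, ← mul_assoc, hs, Fin.val_succ,
        pow_succ, mul_neg_one, neg_smul, neg_mul, smul_neg, neg_neg, mul_smul_comm, mul_assoc]
      rfl

/-- Induction on `m` alone, splitting off `y 0`: the Leibniz rule yields the `j = 0` terms from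
`hone` and the others from the inductive hypothesis. -/
theorem extBracket_ιMulti_ιMulti {n m : ℕ} (x : Fin (n + 1) → X.L) (y : Fin (m + 1) → X.L) :
    X.extBracket (ιMulti X.A (n + 1) x) (ιMulti X.A (m + 1) y) =
      ∑ i : Fin (n + 1), ∑ j : Fin (m + 1), (-1 : R) ^ ((i : ℕ) + (j : ℕ)) •
        (ι X.A (X.bracket (x i) (y j)) * X.extα (ιMulti X.A n (i.removeNth x)
          * ιMulti X.A m (j.removeNth y))) := by
  have hone : ∀ y : X.L, X.extBracket (ιMulti X.A (n + 1) x) (ι X.A y) =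
      ∑ i : Fin (n + 1), (-1 : R) ^ (i : ℕ) •
        (ι X.A (X.bracket (x i) y) * X.extα (ιMulti X.A n (i.removeNth x))) := fun y => by
    rw [extBracket_ι_right (ιMulti_mem x), adVector_ιMulti, ← Finset.sum_neg_distrib]
    refine Finset.sum_congr rfl fun i _ => ?_
    rw [X.isHomLie.skew y, map_neg, neg_mul, smul_neg, neg_neg]
  induction m with
  | zero =>
    rw [ιMulti_succ_apply y, ιMulti_zero_apply, mul_one, hone]
    simp
  | succ m ih =>
    rw [ιMulti_succ_apply y, extBracket_ι_mul_right (ιMulti_mem x), ih, hone, Finset.sum_mul,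
      Finset.mul_sum, Finset.smul_sum, ← Finset.sum_add_distrib]
    refine Finset.sum_congr rfl fun i _ => ?_
    rw [Fin.sum_univ_succ (n := m + 1), ιMulti_removeNth_zero, Finset.mul_sum, Finset.smul_sum]
    congr 1
    · simp [mul_assoc]
    · refine Finset.sum_congr rfl fun j _ => ?_
      have h1 : ι X.A (X.α (y 0)) * ι X.A (X.bracket (x i) (y j.succ)) =
          -(ι X.A (X.bracket (x i) (y j.succ)) * ι X.A (X.α (y 0))) :=
        eq_neg_of_add_eq_zero_left (ι_add_mul_swap _ _)
      have h2 := mul_ι_comm (R := R) (extα_mem (ιMulti_mem (i.removeNth x))) (X.α (y 0))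
      -- `(-1)^n` arises as `α (y 0)` crosses the `n` remaining `x`-factors, `(-1)^(n+1+1)` is the
      -- Leibniz sign, and the extra minus is matched by `h1`.
      have h3 : (-1 : R) ^ ((i : ℕ) + (j.succ : ℕ)) * (-1) ^ n =
          -((-1) ^ (n + 1 + 1) * (-1) ^ ((i : ℕ) + (j : ℕ))) := by
        rw [Fin.val_succ]; ring
      rw [ιMulti_removeNth_succ, map_mul, map_mul, map_mul, extα_ι,
        ← mul_assoc (X.extα (ιMulti X.A n _)), h2, smul_mul_assoc, mul_smul_comm (_ : R) (ι X.A (X.bracket _ _)),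
        mul_smul_comm, smul_smul, smul_smul, h3, neg_smul, ← smul_neg]
      refine congrArg _ ?_
      have h4 : ∀ u w : X.Ext, ι X.A (X.α (y 0)) * (ι X.A (X.bracket (x i) (y j.succ)) * (u * w)) =
          -(ι X.A (X.bracket (x i) (y j.succ)) * (ι X.A (X.α (y 0)) * u * w)) := fun u w => by
        rw [← mul_assoc, h1, neg_mul, mul_assoc, mul_assoc]
      exact h4 _ _

variable (X) in
theorem isSchouten_extStructure : X.IsSchouten X.extStructure where
  α_apply a n x := by
    change X.extα _ = _
    rw [map_mul, extα_algebraMap, extα_ιMulti]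
  bracket_algebraMap n x a := by
    change X.extBracket _ _ = ∑ i : Fin (n + 1), _ • (_ * X.extα _)
    rw [extBracket_algebraMap_right (ιMulti_mem x), adScalar_ιMulti, Finset.smul_sum]
    refine Finset.sum_congr rfl fun i _ => ?_
    rw [pow_succ, mul_neg_one, neg_smul, smul_neg, neg_neg, smul_smul, pow_add]
  bracket_ιMulti n m x y := extBracket_ιMulti_ιMulti x y

/-! ### The universal property -/

section Universal

variable {E : Type v} [Ring E] [Algebra R E] {ℬ : ℕ → Submodule R E} [GradedAlgebra ℬ]

theorem map_mem_of_generators (Θ : X.Ext →ₐ[R] E)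
    (h₀ : ∀ a, Θ (algebraMap X.A X.Ext a) ∈ ℬ 0) (h₁ : ∀ x, Θ (ι X.A x) ∈ ℬ 1)
    {i : ℕ} {U : X.Ext} (hU : U ∈ X.extGrading i) : Θ U ∈ ℬ i := by
  refine homogeneous_induction (P := fun i U => Θ U ∈ ℬ i) h₀ ?_ ?_ hU
  · intro i x y _ _ hx hy
    rw [map_add]
    exact add_mem hx hy
  · intro i x y _ hy
    rw [map_mul, add_comm]
    exact SetLike.GradedMul.mul_mem (h₁ x) hy

/-- The scheme of the Jacobi identity in two slots: Leibniz extends the second slot from generators,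
skew-symmetry exchanges the slots, and Leibniz is used again. -/
theorem isHomGerstenhaberHom_of_generators (T : HomGerstenhaberStructure R ℬ)
    (Θ : X.Ext →ₐ[R] E)
    (h₀ : ∀ a, Θ (algebraMap X.A X.Ext a) ∈ ℬ 0) (h₁ : ∀ x, Θ (ι X.A x) ∈ ℬ 1)
    (hα₀ : ∀ a, T.α (Θ (algebraMap X.A X.Ext a)) = Θ (algebraMap X.A X.Ext (X.φ a)))
    (hα₁ : ∀ x, T.α (Θ (ι X.A x)) = Θ (ι X.A (X.α x)))
    (hρ : ∀ x a, T.bracket (Θ (ι X.A x)) (Θ (algebraMap X.A X.Ext a)) =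
      Θ (algebraMap X.A X.Ext (X.ρ x a)))
    (hL : ∀ x y, T.bracket (Θ (ι X.A x)) (Θ (ι X.A y)) = Θ (ι X.A (X.bracket x y))) :
    IsHomGerstenhaberHom X.extStructure T Θ := by
  have hmem : ∀ {i : ℕ} {U : X.Ext}, U ∈ X.extGrading i → Θ U ∈ ℬ i :=
    map_mem_of_generators Θ h₀ h₁
  have hα : ∀ U, Θ (X.extα U) = T.α (Θ U) := fun U => by
    refine AlgHom.congr_fun (φ₁ := Θ.comp X.extα) (φ₂ := T.α.comp Θ)
      (algHom_ext' (fun a => ?_) fun x => ?_) U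
    · simp [hα₀]
    · simp [hα₁]
  have hext : ∀ {i : ℕ} {U : X.Ext}, U ∈ X.extGrading i →
      (∀ a, Θ (X.extBracket U (algebraMap X.A X.Ext a)) =
        T.bracket (Θ U) (Θ (algebraMap X.A X.Ext a))) →
      (∀ x, Θ (X.extBracket U (ι X.A x)) = T.bracket (Θ U) (Θ (ι X.A x))) →
      ∀ {j : ℕ} {V : X.Ext}, V ∈ X.extGrading j →
        Θ (X.extBracket U V) = T.bracket (Θ U) (Θ V) := by
    intro i U hU ha hx j V hV
    refine homogeneous_induction
      (P := fun j V => Θ (X.extBracket U V) = T.bracket (Θ U) (Θ V)) ha ?_ ?_ hV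
    · intro j V W _ _ hV hW
      simp only [map_add, hV, hW]
    · intro j x W hW h
      rw [extBracket_ι_mul_right hU, map_mul, T.leibniz (hmem hU) (h₁ x) (hmem hW), map_add,
        map_smul, map_mul, map_mul, hx, h, hα, hα₁, mul_one]
  have hskew : ∀ {i j : ℕ} {U V : X.Ext}, U ∈ X.extGrading i → V ∈ X.extGrading j →
      Θ (X.extBracket U V) = T.bracket (Θ U) (Θ V) →
      Θ (X.extBracket V U) = T.bracket (Θ V) (Θ U) := by
    intro i j U V hU hV h
    rw [extBracket_skew hV hU, T.skew (hmem hV) (hmem hU), map_neg, map_smul, h]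
  have hxa : ∀ x a, Θ (X.extBracket (ι X.A x) (algebraMap X.A X.Ext a)) =
      T.bracket (Θ (ι X.A x)) (Θ (algebraMap X.A X.Ext a)) := fun x a => by
    rw [extBracket_ι_left, adVector_algebraMap, hρ]
  have hA : ∀ (a : X.A) {j : ℕ} {V : X.Ext}, V ∈ X.extGrading j →
      Θ (X.extBracket (algebraMap X.A X.Ext a) V) =
        T.bracket (Θ (algebraMap X.A X.Ext a)) (Θ V) := fun a =>
    hext (algebraMap_mem a)
      (fun b => by
        rw [extBracket_algebraMap_left, adScalar_algebraMap, map_zero,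
          T.bracket_zero_zero (h₀ a) (h₀ b)])
      (fun x => hskew (ι_mem x) (algebraMap_mem a) (hxa x a))
  have hX : ∀ (x : X.L) {j : ℕ} {V : X.Ext}, V ∈ X.extGrading j →
      Θ (X.extBracket (ι X.A x) V) = T.bracket (Θ (ι X.A x)) (Θ V) := fun x =>
    hext (ι_mem x) (hxa x) (fun y => by rw [extBracket_ι_left, adVector_ι, hL])
  refine ⟨fun _ _ => hmem, fun U V => ?_, hα⟩
  change Θ (X.extBracket U V) = _
  induction U using DirectSum.Decomposition.inductionOn X.extGrading with
  | zero => simp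
  | add U U' h h' => simp only [map_add, LinearMap.add_apply, h, h']
  | homogeneous U =>
    induction V using DirectSum.Decomposition.inductionOn X.extGrading with
    | zero => simp
    | add V V' h h' => simp only [map_add, h, h']
    | homogeneous V =>
      exact hext U.2 (fun a => hskew (algebraMap_mem a) U.2 (hA a U.2))
        (fun x => hskew (ι_mem x) U.2 (hX x U.2)) V.2

end Universal

theorem isHomGerstenhaberHom_extMap {X Y : HomLieRinehart.{u, v} R} (p : X ⟶ Y) :
    IsHomGerstenhaberHom X.extStructure Y.extStructure (extMap p) := by
  refine isHomGerstenhaberHom_of_generators _ _ (fun a => ?_) (fun x => ?_) (fun a => ?_)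
    (fun x => ?_) (fun x a => ?_) (fun x y => ?_)
  · rw [extMap_algebraMap]; exact algebraMap_mem _
  · rw [extMap_ι]; exact ι_mem _
  · rw [extMap_algebraMap, extMap_algebraMap, p.map_φ]; exact extα_algebraMap _
  · rw [extMap_ι, extMap_ι, p.map_α]; exact extα_ι _
  · rw [extMap_ι, extMap_algebraMap, extMap_algebraMap, p.map_ρ]
    change Y.extBracket _ _ = _
    rw [extBracket_ι_left, adVector_algebraMap]
  · rw [extMap_ι, extMap_ι, extMap_ι, p.map_bracket]
    change Y.extBracket _ _ = _
    rw [extBracket_ι_left, adVector_ι]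

/-- Every homomorphism `(A, L) → (𝒜₀, 𝒜₁)` extends to a homomorphism `∧*_A L → 𝒜`. -/
theorem exists_extend (X : HomLieRinehart.{u, v} R) (Y : HomGerstenhaber.{u, v} R)
    (p : X ⟶ Y.toHomLieRinehart) :
    ∃ Θ : X.Ext →ₐ[R] Y.E, IsHomGerstenhaberHom X.extStructure Y.str Θ ∧
      (∀ a, Θ (algebraMap X.A X.Ext a) = (show Y.deg0 from p.g a).1) ∧
      ∀ x, Θ (ι X.A x) = (show Y.deg1 from p.f x).1 := by
  obtain ⟨Θ, h₀, h₁⟩ := exists_semiLift (R := R) (A := X.A) (L := X.L) (T := Y.E)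
    ({ toFun := fun a => (show Y.deg0 from p.g a).1
       map_one' := congrArg Subtype.val (map_one p.g)
       map_mul' := fun a b => congrArg Subtype.val (map_mul p.g a b)
       map_zero' := congrArg Subtype.val (map_zero p.g)
       map_add' := fun a b => congrArg Subtype.val (map_add p.g a b)
       commutes' := fun r => congrArg Subtype.val (p.g.commutes r) })
    ((Y.grading 1).subtype ∘ₗ p.f)
    (fun a x => congrArg Subtype.val (p.map_smul a x))
    (fun a x => Y.mul_comm0 (show Y.deg0 from p.g a).2 (show Y.deg1 from p.f x).2)
    -- Strict graded commutativity enters here: without it `2` might have to be invertible.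
    (fun x => Y.str.mul_self odd_one (show Y.deg1 from p.f x).2)
  refine ⟨Θ, isHomGerstenhaberHom_of_generators _ _ (fun a => ?_) (fun x => ?_) (fun a => ?_)
    (fun x => ?_) (fun x a => ?_) (fun x y => ?_), h₀, h₁⟩
  · rw [h₀]; exact (show Y.deg0 from p.g a).2
  · rw [h₁]; exact (show Y.deg1 from p.f x).2
  · rw [h₀, h₀]; exact congrArg Subtype.val (p.map_φ a).symm
  · rw [h₁, h₁]; exact congrArg Subtype.val (p.map_α x).symm
  · rw [h₀, h₁, h₀]; exact congrArg Subtype.val (p.map_ρ x a).symm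
  · rw [h₁, h₁, h₁]; exact congrArg Subtype.val (p.map_bracket x y).symm

end HomLieRinehart

/-! ### The adjunction. -/

namespace HomLieRinehart

open ExteriorAlgebra

variable {R : Type u} [CommRing R]

/-- The restriction of a homomorphism `∧*_A L → 𝒜` to `(A, L) → (𝒜₀, 𝒜₁)`. -/
noncomputable def restrictGenerators {X : HomLieRinehart.{u, v} R} {Y : HomGerstenhaber.{u, v} R}
    (Θ : X.Ext →ₐ[R] Y.E) (hΘ : IsHomGerstenhaberHom X.extStructure Y.str Θ) :
    X ⟶ Y.toHomLieRinehart where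
  g :=
    { toFun := fun a => (⟨Θ (algebraMap X.A X.Ext a), hΘ.map_mem (algebraMap_mem a)⟩ : Y.deg0)
      map_one' := Subtype.ext (map_one (Θ.comp (IsScalarTower.toAlgHom R X.A X.Ext)))
      map_mul' := fun a b => Subtype.ext
        (map_mul (Θ.comp (IsScalarTower.toAlgHom R X.A X.Ext)) a b)
      map_zero' := Subtype.ext (map_zero (Θ.comp (IsScalarTower.toAlgHom R X.A X.Ext)))
      map_add' := fun a b => Subtype.ext
        (map_add (Θ.comp (IsScalarTower.toAlgHom R X.A X.Ext)) a b)
      commutes' := fun r => Subtype.ext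
        ((Θ.comp (IsScalarTower.toAlgHom R X.A X.Ext)).commutes r) }
  f :=
    { toFun := fun x => (⟨Θ (ι X.A x), hΘ.map_mem (ι_mem x)⟩ : Y.deg1)
      map_add' := fun x y => Subtype.ext
        (map_add (Θ.toLinearMap ∘ₗ (ι X.A).restrictScalars R) x y)
      map_smul' := fun r x => Subtype.ext
        (map_smul (Θ.toLinearMap ∘ₗ (ι X.A).restrictScalars R) r x) }
  map_smul a x := Subtype.ext (by
    have h : ι X.A (a • x) = algebraMap X.A X.Ext a * ι X.A x := by
      rw [map_smul, Algebra.smul_def]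
    exact (congrArg Θ h).trans (map_mul Θ _ _))
  map_bracket x y := Subtype.ext (by
    have h := hΘ.map_bracket (ι X.A x) (ι X.A y)
    have h' : X.extStructure.bracket (ι X.A x) (ι X.A y) = ι X.A (X.bracket x y) := by
      change X.extBracket _ _ = _
      rw [extBracket_ι_left, adVector_ι]
    rw [h'] at h
    exact h)
  map_α x := Subtype.ext (by
    have h := hΘ.map_α (ι X.A x)
    have h' : X.extStructure.α (ι X.A x) = ι X.A (X.α x) := extα_ι x
    rw [h'] at h
    exact h)
  map_φ a := Subtype.ext (by
    have h := hΘ.map_α (algebraMap X.A X.Ext a)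
    have h' : X.extStructure.α (algebraMap X.A X.Ext a) = algebraMap X.A X.Ext (X.φ a) :=
      extα_algebraMap a
    rw [h'] at h
    exact h)
  map_ρ x a := Subtype.ext (by
    have h := hΘ.map_bracket (ι X.A x) (algebraMap X.A X.Ext a)
    have h' : X.extStructure.bracket (ι X.A x) (algebraMap X.A X.Ext a) =
        algebraMap X.A X.Ext (X.ρ x a) := by
      change X.extBracket _ _ = _
      rw [extBracket_ι_left, adVector_algebraMap]
    rw [h'] at h
    exact h)

/-- Homomorphisms `∧*_A L → 𝒜` correspond to homomorphisms `(A, L) → (𝒜₀, 𝒜₁)`. -/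
noncomputable def extHomEquiv (X : HomLieRinehart.{u, v} R) (Y : HomGerstenhaber.{u, v} R) :
    ((functorG (fun X : HomLieRinehart.{u, v} R => X.extStructure)
      (fun _ _ p => isHomGerstenhaberHom_extMap p)).obj X ⟶ Y) ≃ (X ⟶ (functorF R).obj Y) where
  toFun q := restrictGenerators q.toAlgHom q.isHom
  invFun p := ⟨(exists_extend X Y p).choose, (exists_extend X Y p).choose_spec.1⟩
  left_inv _ := HomGerstenhaber.Hom.ext (algHom_ext'
    (fun a => (exists_extend X Y _).choose_spec.2.1 a)
    (fun x => (exists_extend X Y _).choose_spec.2.2 x))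
  right_inv p := Hom.ext
    (AlgHom.ext fun a => Subtype.ext ((exists_extend X Y p).choose_spec.2.1 a))
    (LinearMap.ext fun x => Subtype.ext ((exists_extend X Y p).choose_spec.2.2 x))

end HomLieRinehart

theorem theorem3 (R : Type u) [CommRing R] :
    ∃ S : ∀ X : HomLieRinehart.{u, v} R, HomGerstenhaberStructure R X.extGrading,
      (∀ X : HomLieRinehart.{u, v} R, X.IsSchouten (S X)) ∧
      ∃ hS : ∀ (X Y : HomLieRinehart.{u, v} R) (p : X ⟶ Y),
          IsHomGerstenhaberHom (S X) (S Y) (HomLieRinehart.extMap p),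
        Nonempty (functorG S hS ⊣ functorF.{u, v} R) := by
  refine ⟨fun X => X.extStructure, HomLieRinehart.isSchouten_extStructure,
    fun _ _ p => HomLieRinehart.isHomGerstenhaberHom_extMap p, ⟨Adjunction.mkOfHomEquiv
    { homEquiv := HomLieRinehart.extHomEquiv
      homEquiv_naturality_left_symm := fun {X' X Y} p q => ?_
      homEquiv_naturality_right := fun _ _ => rfl }⟩⟩
  -- The inverse of the equivalence is only known through its values on generators, so both sides
  -- are compared after restriction to `A` and `L`.
  apply (HomLieRinehart.extHomEquiv X' Y).injective
  rw [Equiv.apply_symm_apply]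
  refine HomLieRinehart.Hom.ext (AlgHom.ext fun a => Subtype.ext ?_)
    (LinearMap.ext fun x => Subtype.ext ?_)
  · exact ((congrArg _ (HomLieRinehart.extMap_algebraMap p a)).trans
      ((HomLieRinehart.exists_extend X Y q).choose_spec.2.1 (p.g a))).symm
  · exact ((congrArg _ (HomLieRinehart.extMap_ι p x)).trans
      ((HomLieRinehart.exists_extend X Y q).choose_spec.2.2 (p.f x))).symm
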